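/- Give $\omega_1+1$ and every $\alpha+1=\{\xi:\xi\le\alpha\}$ ($\alpha<\omega_1$) the order topology, and give $(\omega_1+1)^2$ and $(\omega_1+1)\times(\alpha+1)$ the product topology. Order $(\omega_1+1)^2$ coordinatewise; it is a lattice. A sublattice is a subset closed under binary meets and joins (it need not contain the least or greatest element of the square). Let $\triangle=\{(x,y)\in(\omega_1+1)^2 : x\le y\}$ with the subspace topology. Let $K$ be an uncountable sublattice of $(\omega_1+1)^2$ that is topologically closed, with the subspace topology. Then exactly one of the following holds: 1. $K$ is homeomorphic to $\triangle$; 2. $K$ is homeomorphic to $(\omega_1+1)^2$; 3. there is an ordinal $\alpha<\omega_1$ such that $K$ is homeomorphic to $(\omega_1+1)\times(\alpha+1)$. Consequently, there are exactly $\aleph_1$ homeomorphism types of uncountable closed sublattices of $(\omega_1+1)^2$. -/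

import Mathlib

open Ordinal Cardinal

/-- The ordinal space `α + 1 = {ξ : ξ ≤ α}`. It is a closed initial segment of the ordinals, with the
induced order and the induced topology, which is its order topology. -/
abbrev OrdSpace (α : Ordinal.{0}) : Type 1 := Set.Iic α

/-- The product space `(ω₁ + 1) × (α + 1)`, with product topology and coordinatewise order. -/
abbrev GPlank (α : Ordinal.{0}) : Type 1 := OrdSpace (ω₁ : Ordinal.{0}) × OrdSpace α

/-- The square `(ω₁ + 1)²`. -/
abbrev GSquare : Type 1 := GPlank (ω₁ : Ordinal.{0})

/-- The triangle `{(x, y) ∈ (ω₁ + 1)² : x ≤ y}`; as a space it carries the subspace topology. -/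
def triangle : Set GSquare := {p | p.1 ≤ p.2}

/-- The uncountable closed sublattices of `(ω₁ + 1)²`. A sublattice is a subset closed under binary
meets and joins; it need not contain the least or the greatest element of the square. -/
abbrev UncountableClosedSublattice : Type 1 :=
  {K : Sublattice GSquare // IsClosed (K : Set GSquare) ∧ ¬ (K : Set GSquare).Countable}

/-- Being homeomorphic, as an equivalence relation on uncountable closed sublattices of the square,
each with its subspace topology. -/
def homeoSetoid : Setoid UncountableClosedSublattice where
  r K L := Nonempty (K.1 ≃ₜ L.1)
  iseqv :=
    { refl := fun K => ⟨Homeomorph.refl K.1⟩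
      symm := fun ⟨h⟩ => ⟨h.symm⟩
      trans := fun ⟨h⟩ ⟨k⟩ => ⟨h.trans k⟩ }

/-- The topological types of uncountable closed sublattices of `(ω₁ + 1)²`. -/
def TopologicalTypes : Type 1 := Quotient homeoSetoid

/-! View K as a compact set of pairs of ordinals. Closure under meets and joins makes its vertical
and horizontal sections convex relative to the projections (`SqLat.convex_snd`, `SqLat.convex_fst`),
so its shape is governed by how it approaches the right edge x = ω₁ and the top edge y = ω₁. Order
isomorphisms collapse both projections to initial segments of ω₁ + 1. Countable clopen pieces are
harmless: a nonempty compact subset of a countable square is a countable successor ordinal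
(`exists_bound_rectangle`), and as β + 1 + ω₁ = ω₁ it disappears into a clopen copy of ω₁ + 1
(`SetHomeo.absorb`).

If one projection is countable, a plank remains. Otherwise let a and b be the least heights and
abscissas at which K meets the right and the top edge. If both are countable, K is a full box up to
a countable piece, hence the square. If only one is, say a, then either the points off the right
edge have bounded height and K is a plank, or K is essentially the region under a cofinal staircase,
and all such regions are homeomorphic (`Stair.setHomeo`). If both equal ω₁, K is pinched at the
corner and is a copy of ω₁ + 1, the plank with α = 0.

The last two cases rest on one device. A continuous enumeration d of a club in ω₁, growing fast
enough for the set at hand, cuts off countable compact blocks. Their sizes are controlled, so they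
can be exchanged for other copies; the blocks shrink to the limit points on the diagonal, which
makes the exchange continuous (`SetHomeo.glue`).

The types are told apart by the points with no countable neighbourhood. They form α + 1 in a plank,
the edge ω₁ + 1 in the triangle, and they contain two edges meeting in one point in the square; two
uncountable closed subsets of ω₁ + 1 always share at least two points. Finally, Cantor–Bendixson
derivatives show that each plank is homeomorphic to only countably many others, so there are ℵ₁
types. -/

open Set Topology Filter Order

/-! ### Homeomorphism of subspaces -/

/-- Two sets in topological spaces are homeomorphic as subspaces. -/
def SetHomeo {X Y : Type*} [TopologicalSpace X] [TopologicalSpace Y] (S : Set X) (T : Set Y) :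
    Prop := Nonempty (S ≃ₜ T)

namespace SetHomeo

variable {X Y Z W : Type*} [TopologicalSpace X] [TopologicalSpace Y] [TopologicalSpace Z]
  [TopologicalSpace W]

theorem refl (S : Set X) : SetHomeo S S := ⟨Homeomorph.refl _⟩

theorem symm {S : Set X} {T : Set Y} (h : SetHomeo S T) : SetHomeo T S := h.map Homeomorph.symm

theorem trans {S : Set X} {T : Set Y} {U : Set Z} (h : SetHomeo S T) (k : SetHomeo T U) :
    SetHomeo S U := ⟨h.some.trans k.some⟩

/-- A continuous bijection from a compact space to a Hausdorff space is a homeomorphism, so below it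
mostly suffices to exhibit a continuous injection. -/
theorem image {S : Set X} (hS : IsCompact S) {f : X → Y} [T2Space Y] (hf : ContinuousOn f S)
    (hi : InjOn f S) : SetHomeo S (f '' S) := by
  have : CompactSpace S := isCompact_iff_compactSpace.1 hS
  let e : S ≃ f '' S := Equiv.Set.imageOfInjOn f S hi
  have he : Continuous e := by
    refine Continuous.subtype_mk ?_ _
    exact hf.domRestrict
  exact ⟨he.homeoOfEquivCompactToT2⟩

theorem of_image {S : Set X} (hS : IsCompact S) {f : X → Y} [T2Space Y] (hf : ContinuousOn f S)
    (hi : InjOn f S) {T : Set Y} (hT : f '' S = T) : SetHomeo S T := hT ▸ image hS hf hi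

/-- A homeomorphism between subspaces extends to a (total) function of the ambient spaces. -/
theorem exists_fun [Nonempty Y] {S : Set X} {T : Set Y} (h : SetHomeo S T) :
    ∃ f : X → Y, ContinuousOn f S ∧ InjOn f S ∧ f '' S = T := by
  classical
  obtain ⟨e⟩ := h
  refine ⟨fun x => if hx : x ∈ S then e ⟨x, hx⟩ else Classical.arbitrary Y, ?_, ?_, ?_⟩
  · rw [continuousOn_iff_continuous_domRestrict]
    have : S.domRestrict (fun x => if hx : x ∈ S then (e ⟨x, hx⟩ : Y) else Classical.arbitrary Y)
        = fun x => (e x : Y) := by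
      ext x; simp
    rw [this]; fun_prop
  · intro x hx y hy hxy
    simp only [hx, hy, dif_pos] at hxy
    simpa using e.injective (Subtype.ext hxy)
  · ext y; constructor
    · rintro ⟨x, hx, rfl⟩; simp only [hx, dif_pos]; exact (e _).2
    · intro hy
      refine ⟨e.symm ⟨y, hy⟩, (e.symm ⟨y, hy⟩).2, ?_⟩
      simp

theorem countable {S : Set X} {T : Set Y} (h : SetHomeo S T) (hS : S.Countable) : T.Countable := by
  have := hS.to_subtype
  exact Set.countable_coe_iff.1 (h.some.symm.injective.countable)

theorem isCompact {S : Set X} {T : Set Y} (h : SetHomeo S T) (hS : IsCompact S) : IsCompact T := by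
  have := isCompact_iff_compactSpace.1 hS
  exact isCompact_iff_compactSpace.2 h.some.compactSpace

theorem prod {S : Set X} {T : Set Y} {S' : Set Z} {T' : Set W} (h : SetHomeo S T)
    (h' : SetHomeo S' T') : SetHomeo (S ×ˢ S') (T ×ˢ T') :=
  ⟨(Homeomorph.Set.prod S S').trans ((h.some.prodCongr h'.some).trans
    (Homeomorph.Set.prod T T').symm)⟩

end SetHomeo

/-! ### Countable ordinals and the collapse of compact sets of ordinals -/

theorem isCompact_Iic_ordinal (α : Ordinal.{0}) : IsCompact (Iic α) := by
  have : Iic α = Icc 0 α := by ext; simp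
  rw [this]; exact isCompact_Icc

theorem countable_Iio_iff_lt_omega_one {α : Ordinal.{0}} : (Iio α).Countable ↔ α < ω₁ := by
  rw [← Cardinal.le_aleph0_iff_set_countable, Cardinal.mk_Iio_ordinal, ← Cardinal.lift_aleph0.{1, 0},
    Cardinal.lift_le, ← Order.lt_succ_iff, Cardinal.succ_aleph0, ← Cardinal.lt_ord,
    Cardinal.ord_aleph]

theorem succ_lt_omega_one {α : Ordinal.{0}} (h : α < ω₁) : α + 1 < ω₁ :=
  (Cardinal.isSuccLimit_omega 1).add_one_lt h

theorem countable_Iic_of_lt {α : Ordinal.{0}} (h : α < ω₁) : (Iic α).Countable := by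
  have : Iic α = Iio (α + 1) := by ext; simp [Order.lt_add_one_iff]
  rw [this, countable_Iio_iff_lt_omega_one]; exact succ_lt_omega_one h

theorem lt_omega_one_of_countable_Iic {α : Ordinal.{0}} (h : (Iic α).Countable) : α < ω₁ :=
  countable_Iio_iff_lt_omega_one.1 (h.mono Iio_subset_Iic_self)

/-- Regularity of ω₁: countably many countable bounds have a countable supremum. -/
theorem exists_bound_lt_omega_one {C : Set Ordinal.{0}} (hC : C.Countable) {φ : Ordinal.{0} → Ordinal.{0} → Prop}
    (h : ∀ y ∈ C, ∃ β < ω₁, φ y β) (hφ : ∀ y β β', β ≤ β' → φ y β → φ y β') :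
    ∃ β < ω₁, ∀ y ∈ C, φ y β := by
  have := hC.to_subtype
  choose! f hf hf' using h
  refine ⟨⨆ y : C, f y, Ordinal.iSup_lt_omega_one fun y => hf y y.2, fun y hy => ?_⟩
  refine hφ _ _ _ ?_ (hf' y hy)
  have : Small.{0} C := Countable.toSmall _
  exact Ordinal.le_iSup (fun y : C => f y) ⟨y, hy⟩

/-- Collapse of a nonempty compact set of ordinals onto a closed initial segment. -/
theorem exists_collapse {C : Set Ordinal.{0}} (hC : IsCompact C) (hne : C.Nonempty) :
    ∃ (e : Ordinal.{0} → Ordinal.{0}) (α : Ordinal.{0}), StrictMonoOn e C ∧ ContinuousOn e C ∧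
      e '' C = Iic α ∧ ∀ B, C ⊆ Iic B → α ≤ B := by
  classical
  obtain ⟨m, hm⟩ := hC.exists_isGreatest hne
  let r : ((· < ·) : C → C → Prop) ↪r ((· < ·) : Ordinal.{0} → Ordinal.{0} → Prop) :=
    ⟨⟨Subtype.val, Subtype.val_injective⟩, Iff.rfl⟩
  let c := r.collapse
  have hc : StrictMono c := fun a b h => c.map_rel_iff.2 h
  have hrange : range c = Iic (c ⟨m, hm.1⟩) := by
    ext y; constructor
    · rintro ⟨x, rfl⟩
      exact hc.monotone (hm.2 x.2)
    · intro hy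
      rcases (show y ≤ _ from hy).lt_or_eq with h | h
      · obtain ⟨a, ha⟩ := c.mem_range_of_rel h
        exact ⟨a, ha⟩
      · exact ⟨_, h.symm⟩
  -- The range is an initial segment, so the preimage of an open ray is a ray, empty, or everything.
  have hcont : Continuous c := by
    rw [OrderTopology.continuous_iff]
    intro a
    constructor
    · by_cases ha : a ∈ range c
      · obtain ⟨x, rfl⟩ := ha
        have : c ⁻¹' Ioi (c x) = Ioi x := by ext z; simp [hc.lt_iff_lt]
        rw [this]; exact isOpen_Ioi
      · have : c ⁻¹' Ioi a = ∅ := by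
          ext z
          simp only [mem_preimage, mem_Ioi, mem_empty_iff_false, iff_false]
          intro hz
          exact ha (c.mem_range_of_rel hz)
        rw [this]; exact isOpen_empty
    · by_cases ha : a ∈ range c
      · obtain ⟨x, rfl⟩ := ha
        have : c ⁻¹' Iio (c x) = Iio x := by ext z; simp [hc.lt_iff_lt]
        rw [this]; exact isOpen_Iio
      · have : c ⁻¹' Iio a = Set.univ := by
          ext z
          simp only [mem_preimage, mem_Iio, Set.mem_univ, iff_true]
          by_contra hz
          rcases (not_lt.1 hz).lt_or_eq with h | h
          · exact ha (c.mem_range_of_rel h)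
          · exact ha ⟨z, h.symm⟩
        rw [this]; exact isOpen_univ
  -- The collapse never increases a point; this gives the bound on α.
  have hle : ∀ x : C, c x ≤ x := by
    intro x
    induction x using WellFoundedLT.induction with
    | ind x ih =>
      by_contra! hlt
      obtain ⟨y, hy⟩ := c.mem_range_of_rel hlt
      have hyx : y < x := hc.lt_iff_lt.1 (hy ▸ hlt)
      have := ih y hyx
      rw [hy] at this
      exact absurd hyx (not_lt.2 this)
  refine ⟨fun x => if hx : x ∈ C then c ⟨x, hx⟩ else 0, c ⟨m, hm.1⟩, ?_, ?_, ?_, ?_⟩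
  · intro x hx y hy hxy
    simp only [hx, hy, dif_pos]
    exact hc hxy
  · rw [continuousOn_iff_continuous_domRestrict]
    convert hcont using 1
    ext x; simp
  · rw [← hrange]
    ext y; constructor
    · rintro ⟨x, hx, rfl⟩; exact ⟨⟨x, hx⟩, by simp [hx]⟩
    · rintro ⟨x, rfl⟩; exact ⟨x, x.2, by simp⟩
  · intro B hB
    exact (hle _).trans (hB hm.1)

/-- Left translation by a is a normal function, hence a continuous injection. -/
theorem setHomeo_Icc {a b c : Ordinal.{0}} (h : a + c = b) : SetHomeo (Icc a b) (Iic c) := by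
  refine SetHomeo.symm (SetHomeo.of_image (isCompact_Iic_ordinal c) (f := fun x => a + x) ?_ ?_ ?_)
  · exact (Ordinal.isNormal_add_right a).continuous.continuousOn
  · intro x _ y _ hxy
    simpa using hxy
  · subst h
    ext y; constructor
    · rintro ⟨x, hx, rfl⟩
      exact ⟨le_self_add, by simpa using hx⟩
    · rintro ⟨h1, h2⟩
      refine ⟨y - a, ?_, Ordinal.add_sub_cancel_of_le h1⟩
      rw [← Ordinal.add_sub_cancel_of_le h1] at h2
      simpa using h2

theorem add_omega_one {a : Ordinal.{0}} (h : a < ω₁) : a + ω₁ = ω₁ :=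
  (Ordinal.isPrincipal_add_omega 1).add_eq_right h

theorem add_lt_omega_one {a b : Ordinal.{0}} (ha : a < ω₁) (hb : b < ω₁) : a + b < ω₁ :=
  (Ordinal.isPrincipal_add_omega 1) ha hb

/-! ### Gluing and disjoint unions -/

/-- Replacing relatively open pieces `P i` of a compact set by homeomorphic pieces `Q i`, and fixing
the remaining points, is a homeomorphism when it is continuous at the remaining points. -/
theorem SetHomeo.glue {Z ι : Type*} [TopologicalSpace Z] [T2Space Z] {X Y M : Set Z}
    {P Q : ι → Set Z} (hXc : IsCompact X) (hX : X = M ∪ ⋃ i, P i) (hY : Y = M ∪ ⋃ i, Q i)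
    (hP : ∀ i j z, z ∈ P i → z ∈ P j → i = j) (hQ : ∀ i j z, z ∈ Q i → z ∈ Q j → i = j)
    (hMP : ∀ i, ∀ z ∈ M, z ∉ P i) (hMQ : ∀ i, ∀ z ∈ M, z ∉ Q i)
    (hopen : ∀ i, ∀ z ∈ P i, P i ∈ 𝓝[X] z) (hPQ : ∀ i, SetHomeo (P i) (Q i))
    (hloc : ∀ z ∈ M, ∀ W ∈ 𝓝 z, ∀ᶠ q in 𝓝 z, ∀ i, q ∈ P i → Q i ⊆ W) : SetHomeo X Y := by
  classical
  rcases isEmpty_or_nonempty Z with hZ | hZ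
  · rw [Set.eq_empty_of_isEmpty X, Set.eq_empty_of_isEmpty Y]
    exact SetHomeo.refl (∅ : Set Z)
  -- These homeomorphisms are arbitrary, so continuity at points of M can only come from whole
  -- target pieces `Q i` being small, as `hloc` demands.
  choose e hec hei heim using fun i => (hPQ i).exists_fun
  let f : Z → Z := fun z => if h : ∃ i, z ∈ P i then e h.choose z else z
  have hfP : ∀ i, ∀ z ∈ P i, f z = e i z := by
    intro i z hz
    have h : ∃ i, z ∈ P i := ⟨i, hz⟩
    simp only [f, dif_pos h]
    rw [hP _ _ z h.choose_spec hz]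
  have hfM : ∀ z ∈ M, f z = z := by
    intro z hz
    have h : ¬ ∃ i, z ∈ P i := fun ⟨i, hi⟩ => hMP i z hz hi
    simp only [f, dif_neg h]
  have heQ : ∀ i, ∀ z ∈ P i, e i z ∈ Q i := fun i z hz => heim i ▸ mem_image_of_mem _ hz
  refine SetHomeo.of_image (f := f) hXc ?_ ?_ ?_
  · intro z hz
    rw [hX] at hz
    rcases hz with hz | hz
    · rw [ContinuousWithinAt, hfM z hz]
      intro W hW
      rw [mem_map]
      filter_upwards [self_mem_nhdsWithin, mem_nhdsWithin_of_mem_nhds hW,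
        mem_nhdsWithin_of_mem_nhds (hloc z hz W hW)] with q hq hqW hqQ
      rw [hX] at hq
      rcases hq with hq | hq
      · rw [mem_preimage, hfM q hq]; exact hqW
      · obtain ⟨i, hi⟩ := mem_iUnion.1 hq
        rw [mem_preimage, hfP i q hi]
        exact hqQ i hi (heQ i q hi)
    · obtain ⟨i, hi⟩ := mem_iUnion.1 hz
      have h1 : ContinuousWithinAt f (P i) z :=
        ((hec i) z hi).congr (fun y hy => hfP i y hy) (hfP i z hi)
      exact h1.mono_of_mem_nhdsWithin (hopen i z hi)
  · intro x hx y hy hxy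
    rw [hX] at hx hy
    rcases hx with hx | hx <;> rcases hy with hy | hy
    · rwa [hfM x hx, hfM y hy] at hxy
    · obtain ⟨i, hi⟩ := mem_iUnion.1 hy
      rw [hfM x hx, hfP i y hi] at hxy
      exact absurd (hxy ▸ heQ i y hi) (hMQ i x hx)
    · obtain ⟨i, hi⟩ := mem_iUnion.1 hx
      rw [hfM y hy, hfP i x hi] at hxy
      exact absurd (hxy ▸ heQ i x hi) (hMQ i y hy)
    · obtain ⟨i, hi⟩ := mem_iUnion.1 hx
      obtain ⟨j, hj⟩ := mem_iUnion.1 hy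
      rw [hfP i x hi, hfP j y hj] at hxy
      obtain rfl : i = j := hQ i j _ (heQ i x hi) (hxy ▸ heQ j y hj)
      exact hei i hi hj hxy
  · ext z; rw [hX, hY]; constructor
    · rintro ⟨x, hx | hx, rfl⟩
      · rw [hfM x hx]; exact Or.inl hx
      · obtain ⟨i, hi⟩ := mem_iUnion.1 hx
        rw [hfP i x hi]; exact Or.inr (mem_iUnion.2 ⟨i, heQ i x hi⟩)
    · rintro (hz | hz)
      · exact ⟨z, Or.inl hz, hfM z hz⟩
      · obtain ⟨i, hi⟩ := mem_iUnion.1 hz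
        rw [← heim i] at hi
        obtain ⟨x, hx, rfl⟩ := hi
        exact ⟨x, Or.inr (mem_iUnion.2 ⟨i, hx⟩), hfP i x hx⟩

theorem ContinuousOn.ite_mem_of_isClosed {X Y : Type*} [TopologicalSpace X] [TopologicalSpace Y]
    {L K : Set X} (hL : IsClosed L) (hK : IsClosed K) (hd : Disjoint L K) {f g : X → Y}
    (hf : ContinuousOn f L) (hg : ContinuousOn g K) [∀ x, Decidable (x ∈ L)] :
    ContinuousOn (fun x => if x ∈ L then f x else g x) (L ∪ K) := by
  refine ContinuousOn.union_of_isClosed ?_ ?_ hL hK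
  · exact hf.congr fun x hx => by simp [hx]
  · exact hg.congr fun x hx => by simp [hd.notMem_of_mem_right hx]

/-- K is placed after L: L fills the values up to and including β, so K is shifted by β + 1. -/
theorem SetHomeo.union_Iic {Z : Type*} [TopologicalSpace Z] [T2Space Z] {L K : Set Z}
    {β η : Ordinal.{0}} (hLc : IsCompact L) (hKc : IsCompact K) (hd : Disjoint L K)
    (hL : SetHomeo L (Iic β)) (hK : SetHomeo K (Iic η)) :
    SetHomeo (L ∪ K) (Iic (β + 1 + η)) := by
  classical
  obtain ⟨f, hfc, hfi, hf⟩ := hL.exists_fun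
  obtain ⟨g, hgc, hgi, hg⟩ := hK.exists_fun
  have hfL : ∀ x ∈ L, f x ≤ β := fun x hx => by
    have := mem_image_of_mem f hx; rw [hf] at this; exact this
  have hlt : ∀ x ∈ L, ∀ y, f x < β + 1 + y := fun x hx y =>
    (Order.lt_add_one_iff.2 (hfL x hx)).trans_le le_self_add
  have hKL : ∀ x ∈ K, x ∉ L := fun x hx => hd.notMem_of_mem_right hx
  refine SetHomeo.of_image (f := fun x => if x ∈ L then f x else β + 1 + g x) (hLc.union hKc)
    (ContinuousOn.ite_mem_of_isClosed hLc.isClosed hKc.isClosed hd hfc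
      ((Ordinal.isNormal_add_right (β + 1)).continuous.comp_continuousOn hgc)) ?_ ?_
  · rintro x (hx | hx) y (hy | hy) hxy
    · simp only [hx, hy, if_true] at hxy; exact hfi hx hy hxy
    · simp only [hx, hKL y hy, if_true, if_false] at hxy
      exact absurd hxy (hlt x hx _).ne
    · simp only [hy, hKL x hx, if_true, if_false] at hxy
      exact absurd hxy (hlt y hy _).ne'
    · simp only [hKL x hx, hKL y hy, if_false, add_right_inj] at hxy
      exact hgi hx hy (by simpa using hxy)
  · ext z; constructor
    · rintro ⟨x, hx | hx, rfl⟩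
      · simp only [hx, if_true]; exact (hlt x hx _).le
      · simp only [hKL x hx, if_false]
        have := mem_image_of_mem g hx; rw [hg] at this
        simpa using this
    · intro hz
      rcases le_or_gt z β with h | h
      · have : z ∈ f '' L := hf ▸ h
        obtain ⟨x, hx, rfl⟩ := this
        exact ⟨x, Or.inl hx, by simp [hx]⟩
      · have h' := Order.add_one_le_iff.2 h
        have : z - (β + 1) ∈ g '' K := by
          rw [hg, mem_Iic]
          rw [mem_Iic, ← Ordinal.add_sub_cancel_of_le h'] at hz
          simpa using hz
        obtain ⟨x, hx, hxz⟩ := this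
        refine ⟨x, Or.inr hx, ?_⟩
        simp only [hKL x hx, if_false, hxz]
        exact Ordinal.add_sub_cancel_of_le (Order.add_one_le_iff.2 h)

/-! ### Compact subsets of countable squares -/

/-- Continuous injectability of a set into a bounded set of ordinals. -/
def Emb {X : Type*} [TopologicalSpace X] (S : Set X) (B : Ordinal.{0}) : Prop :=
  ∃ h : X → Ordinal.{0}, ContinuousOn h S ∧ InjOn h S ∧ ∀ s ∈ S, h s ≤ B

theorem Emb.mono {X : Type*} [TopologicalSpace X] {S T : Set X} {B : Ordinal.{0}} (h : Emb T B)
    (hST : S ⊆ T) : Emb S B := by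
  obtain ⟨f, h1, h2, h3⟩ := h
  exact ⟨f, h1.mono hST, h2.mono hST, fun s hs => h3 s (hST hs)⟩

theorem Emb.of_clopen {X : Type*} [TopologicalSpace X] {S U : Set X} {B B' : Ordinal.{0}}
    (hU : IsClopen U) (h : Emb (S ∩ U) B) (h' : Emb (S ∩ Uᶜ) B') : Emb S (B + 1 + B') := by
  classical
  obtain ⟨f, h1, h2, h3⟩ := h
  obtain ⟨g, k1, k2, k3⟩ := h'
  have hlt : ∀ x ∈ S ∩ U, ∀ y, f x < B + 1 + y := fun x hx y =>
    (Order.lt_add_one_iff.2 (h3 x hx)).trans_le le_self_add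
  refine ⟨fun x => if x ∈ U then f x else B + 1 + g x, ?_, ?_, ?_⟩
  · intro x hx
    by_cases hxU : x ∈ U
    · have : ContinuousWithinAt (fun x => if x ∈ U then f x else B + 1 + g x) (S ∩ U) x :=
        (h1 x ⟨hx, hxU⟩).congr (fun y hy => by simp [hy.2]) (by simp [hxU])
      exact this.mono_of_mem_nhdsWithin
        (inter_mem self_mem_nhdsWithin (mem_nhdsWithin_of_mem_nhds (hU.isOpen.mem_nhds hxU)))
    · have : ContinuousWithinAt (fun x => if x ∈ U then f x else B + 1 + g x) (S ∩ Uᶜ) x :=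
        (((Ordinal.isNormal_add_right (B + 1)).continuous.comp_continuousOn k1) x ⟨hx, hxU⟩).congr
          (fun y hy => by simp [show y ∉ U from hy.2]) (by simp [hxU])
      exact this.mono_of_mem_nhdsWithin (inter_mem self_mem_nhdsWithin
        (mem_nhdsWithin_of_mem_nhds (hU.compl.isOpen.mem_nhds hxU)))
  · intro x hx y hy hxy
    by_cases hxU : x ∈ U <;> by_cases hyU : y ∈ U <;> simp only [hxU, hyU, if_true, if_false] at hxy
    · exact h2 ⟨hx, hxU⟩ ⟨hy, hyU⟩ hxy
    · exact absurd hxy (hlt x ⟨hx, hxU⟩ _).ne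
    · exact absurd hxy (hlt y ⟨hy, hyU⟩ _).ne'
    · exact k2 ⟨hx, hxU⟩ ⟨hy, hyU⟩ (by simpa using hxy)
  · intro x hx
    by_cases hxU : x ∈ U <;> simp only [hxU, if_true, if_false]
    · exact (hlt x ⟨hx, hxU⟩ _).le
    · have := k3 x ⟨hx, hxU⟩
      simpa using this

/-- The rings between consecutive clopen neighbourhoods go into consecutive intervals of ordinals,
and x goes to the supremum. Continuity at x holds because `V n` is mapped above the start of the nth
interval. -/
theorem Emb.of_sequence {X : Type*} [TopologicalSpace X] {S : Set X} {x : X} {V : ℕ → Set X}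
    (hx : ∀ n, x ∈ V n) (hV : ∀ n, IsClopen (V n)) (hanti : Antitone V) (h0 : V 0 = Set.univ)
    (hbasis : ∀ W ∈ 𝓝 x, ∃ n, S ∩ V n ⊆ W) [T1Space X]
    (hemb : ∀ n, ∃ B, Emb (S ∩ V n ∩ (V (n + 1))ᶜ) B) : ∃ B, Emb S B := by
  classical
  choose B f hfc hfi hfB using hemb
  -- Ring n takes values up to and including `B n`, so it needs `B n + 1` places.
  let c : ℕ → Ordinal.{0} := fun n => Nat.rec 0 (fun n c => c + (B n + 1)) n
  have hcs : ∀ n, c (n + 1) = c n + (B n + 1) := fun n => rfl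
  have hcm : StrictMono c := strictMono_nat_of_lt_succ fun n => by
    rw [hcs]; exact (lt_add_iff_pos_right _).2 (add_pos_of_right zero_lt_one _)
  let T := ⨆ n, c n
  have hcT : ∀ n, c n ≤ T := Ordinal.le_iSup c
  have hex : ∀ y ∈ S, y ≠ x → ∃ n, y ∈ V n ∧ y ∉ V (n + 1) := by
    intro y hy hyx
    obtain ⟨n, hn⟩ := hbasis {y}ᶜ (isOpen_compl_singleton.mem_nhds (Ne.symm hyx))
    have hyn : ∃ n, y ∉ V n := ⟨n, fun h => hn ⟨hy, h⟩ rfl⟩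
    obtain ⟨m, hm⟩ : ∃ m, Nat.find hyn = m + 1 := by
      refine Nat.exists_eq_succ_of_ne_zero fun h => ?_
      have := Nat.find_spec hyn
      rw [h, h0] at this
      exact this (Set.mem_univ y)
    refine ⟨m, ?_, hm ▸ Nat.find_spec hyn⟩
    by_contra h
    have := Nat.find_min' hyn h
    omega
  have huniq : ∀ y n m, y ∈ V n → y ∉ V (n + 1) → y ∈ V m → y ∉ V (m + 1) → n = m := by
    intro y n m h1 h2 h3 h4
    by_contra hne
    rcases Nat.lt_or_gt_of_ne hne with h | h
    · exact h2 (hanti (show n + 1 ≤ m from h) h3)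
    · exact h4 (hanti (show m + 1 ≤ n from h) h1)
  let g : X → Ordinal.{0} := fun y => if h : ∃ n, y ∈ V n ∧ y ∉ V (n + 1) then
    c h.choose + f h.choose y else T
  have hg : ∀ y n, y ∈ V n → y ∉ V (n + 1) → g y = c n + f n y := by
    intro y n h1 h2
    have h : ∃ n, y ∈ V n ∧ y ∉ V (n + 1) := ⟨n, h1, h2⟩
    simp only [g, dif_pos h]
    rw [huniq y _ n h.choose_spec.1 h.choose_spec.2 h1 h2]
  have hgx : g x = T := by
    have h : ¬ ∃ n, x ∈ V n ∧ x ∉ V (n + 1) := fun ⟨n, hn⟩ => hn.2 (hx _)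
    simp only [g, dif_neg h]
  have hlt : ∀ y ∈ S, ∀ n, y ∈ V n → y ∉ V (n + 1) → g y < c (n + 1) := by
    intro y hy n h1 h2
    rw [hg y n h1 h2, hcs]
    have := hfB n y ⟨⟨hy, h1⟩, h2⟩
    simpa using this
  have hge : ∀ y ∈ S, ∀ n, y ∈ V n → c n ≤ g y := by
    intro y hy n hn
    by_cases hyx : y = x
    · rw [hyx, hgx]; exact hcT n
    · obtain ⟨m, h1, h2⟩ := hex y hy hyx
      rw [hg y m h1 h2]
      have : n ≤ m := by
        by_contra h
        exact h2 (hanti (show m + 1 ≤ n by omega) hn)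
      exact (hcm.monotone this).trans le_self_add
  have hle : ∀ y ∈ S, g y ≤ T := by
    intro y hy
    by_cases hyx : y = x
    · rw [hyx, hgx]
    · obtain ⟨m, h1, h2⟩ := hex y hy hyx
      exact (hlt y hy m h1 h2).le.trans (hcT (m + 1))
  have hltT : ∀ y ∈ S, y ≠ x → g y < T := by
    intro y hy hyx
    obtain ⟨m, h1, h2⟩ := hex y hy hyx
    exact (hlt y hy m h1 h2).trans_le (hcT (m + 1))
  refine ⟨T, g, ?_, ?_, hle⟩
  · intro y hy
    by_cases hyx : y = x
    · subst hyx
      rw [ContinuousWithinAt, hgx, tendsto_order]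
      constructor
      · intro a ha
        obtain ⟨n, hn⟩ := (Ordinal.lt_iSup_iff).1 ha
        filter_upwards [self_mem_nhdsWithin,
          mem_nhdsWithin_of_mem_nhds ((hV n).isOpen.mem_nhds (hx n))] with z hz hzn
        exact hn.trans_le (hge z hz n hzn)
      · intro a ha
        filter_upwards [self_mem_nhdsWithin] with z hz
        exact (hle z hz).trans_lt ha
    · obtain ⟨m, h1, h2⟩ := hex y hy hyx
      have : ContinuousWithinAt g (S ∩ V m ∩ (V (m + 1))ᶜ) y :=
        (((Ordinal.isNormal_add_right (c m)).continuous.comp_continuousOn (hfc m)) y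
          ⟨⟨hy, h1⟩, h2⟩).congr (fun z hz => hg z m hz.1.2 hz.2) (hg y m h1 h2)
      exact this.mono_of_mem_nhdsWithin (inter_mem (inter_mem self_mem_nhdsWithin
        (mem_nhdsWithin_of_mem_nhds ((hV m).isOpen.mem_nhds h1)))
        (mem_nhdsWithin_of_mem_nhds ((hV (m + 1)).compl.isOpen.mem_nhds h2)))
  · intro y hy z hz hyz
    by_cases hyx : y = x
    · by_contra hne
      have := hltT z hz (fun h => hne (hyx.trans h.symm))
      rw [← hyz, hyx, hgx] at this
      exact lt_irrefl _ this
    · by_cases hzx : z = x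
      · have := hltT y hy hyx
        rw [hyz, hzx, hgx] at this
        exact absurd this (lt_irrefl _)
      · obtain ⟨m, h1, h2⟩ := hex y hy hyx
        obtain ⟨n, k1, k2⟩ := hex z hz hzx
        have hmn : m = n := by
          by_contra hne
          rcases Nat.lt_or_gt_of_ne hne with h | h
          · exact absurd hyz ((hlt y hy m h1 h2).trans_le ((hcm.monotone h).trans
              (hge z hz n k1))).ne
          · exact absurd hyz ((hlt z hz n k1 k2).trans_le ((hcm.monotone h).trans
              (hge y hy m h1))).ne'
        subst hmn
        rw [hg y m h1 h2, hg z m k1 k2] at hyz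
        exact hfi m ⟨⟨hy, h1⟩, h2⟩ ⟨⟨hz, k1⟩, k2⟩ (by simpa using hyz)

theorem isClopen_Ioi_ordinal (a : Ordinal.{0}) : IsClopen (Ioi a) := by
  refine ⟨?_, isOpen_Ioi⟩
  have : Ioi a = Ici (a + 1) := by ext; simp [Order.add_one_le_iff]
  rw [this]; exact isClosed_Ici

theorem isClopen_Iic_ordinal (a : Ordinal.{0}) : IsClopen (Iic a) := by
  rw [← compl_Ioi]; exact (isClopen_Ioi_ordinal a).compl

/-- Enumerate the countably many ordinals below α and stay above the first n of them. The last
clause drives the induction on rectangles: what lies outside a neighbourhood is inside a strictly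
smaller initial segment. -/
theorem exists_clopen_basis {α : Ordinal.{0}} (hα : α < ω₁) :
    ∃ A : ℕ → Set Ordinal.{0}, (∀ n, IsClopen (A n)) ∧ Antitone A ∧ A 0 = Set.univ ∧ (∀ n, α ∈ A n) ∧
      (∀ W ∈ 𝓝 α, ∃ n, Iic α ∩ A n ⊆ W) ∧ ∀ n, (Iic α ∩ (A n)ᶜ = ∅) ∨ ∃ α' < α, (A n)ᶜ ⊆ Iic α' := by
  rcases eq_or_ne α 0 with rfl | h0
  · refine ⟨fun _ => Set.univ, fun _ => isClopen_univ, fun _ _ _ => subset_rfl, rfl,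
      fun _ => Set.mem_univ _, fun W hW => ⟨0, ?_⟩, fun n => Or.inl (by simp)⟩
    intro x hx
    have : x = 0 := by simpa using hx
    exact this ▸ mem_of_mem_nhds hW
  · have hc := (countable_Iio_iff_lt_omega_one.2 hα)
    have hne : (Iio α).Nonempty := ⟨0, pos_iff_ne_zero.2 h0⟩
    obtain ⟨s, hs⟩ := hc.exists_eq_range hne
    have hsα : ∀ n, s n < α := fun n => by
      have : s n ∈ Iio α := hs ▸ mem_range_self n
      exact this
    refine ⟨fun n => ⋂ i ∈ Finset.range n, Ioi (s i), fun n => ?_, ?_, by simp, ?_, ?_, ?_⟩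
    · exact isClopen_biInter_finset fun i _ => isClopen_Ioi_ordinal _
    · intro n m hnm
      exact biInter_subset_biInter_left fun i hi => Finset.mem_range.2
        ((Finset.mem_range.1 hi).trans_le hnm)
    · intro n
      simp only [mem_iInter]
      exact fun i _ => hsα i
    · intro W hW
      obtain ⟨a, ha, haW⟩ := exists_Ioc_subset_of_mem_nhds hW ⟨0, pos_iff_ne_zero.2 h0⟩
      have : a ∈ range s := hs ▸ ha
      obtain ⟨i, rfl⟩ := this
      refine ⟨i + 1, fun x hx => haW ⟨?_, hx.1⟩⟩
      have := mem_iInter₂.1 hx.2 i (by simp)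
      exact this
    · intro n
      right
      induction n with
      | zero => exact ⟨0, pos_iff_ne_zero.2 h0, by simp⟩
      | succ n ih =>
        obtain ⟨α', h1, h2⟩ := ih
        refine ⟨max α' (s n), max_lt h1 (hsα n), ?_⟩
        intro x hx
        simp only [] at hx
        rw [Finset.range_add_one, Finset.set_biInter_insert, compl_inter] at hx
        rcases hx with hx | hx
        · exact le_max_of_le_right (by simpa using hx)
        · exact le_max_of_le_left (show x ≤ α' from h2 hx)

/-- Induction on both sides. Removing a clopen box around the corner (α, β) leaves two disjoint
clopen pieces, one in a shorter rectangle and one in a narrower rectangle; the rings around the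
corner are then assembled by `Emb.of_sequence`. -/
theorem emb_rectangle (α : Ordinal.{0}) (hα : α < ω₁) (β : Ordinal.{0}) (hβ : β < ω₁) :
    ∃ B, Emb (Iic α ×ˢ Iic β) B := by
  induction α using WellFoundedLT.induction generalizing β with
  | ind α ihα =>
  induction β using WellFoundedLT.induction with
  | ind β ihβ =>
  obtain ⟨A, hA1, hA2, hA3, hA4, hA5, hA6⟩ := exists_clopen_basis hα
  obtain ⟨C, hC1, hC2, hC3, hC4, hC5, hC6⟩ := exists_clopen_basis hβ
  have hempty : ∀ T : Set (Ordinal.{0} × Ordinal.{0}), T = ∅ → ∃ B, Emb T B := by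
    rintro T rfl
    exact ⟨0, fun _ => 0, by simp, by simp, by simp⟩
  refine Emb.of_sequence (x := (α, β)) (V := fun n => A n ×ˢ C n) (fun n => ⟨hA4 n, hC4 n⟩)
    (fun n => (hA1 n).prod (hC1 n)) (fun n m h => prod_mono (hA2 h) (hC2 h)) (by simp [hA3, hC3])
    ?_ ?_
  · intro W hW
    rw [nhds_prod_eq, Filter.mem_prod_iff] at hW
    obtain ⟨U, hU, U', hU', h⟩ := hW
    obtain ⟨n, hn⟩ := hA5 U hU
    obtain ⟨m, hm⟩ := hC5 U' hU'
    refine ⟨max n m, ?_⟩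
    rintro ⟨x, y⟩ ⟨⟨h1, h2⟩, h3, h4⟩
    exact h ⟨hn ⟨h1, hA2 (le_max_left n m) h3⟩, hm ⟨h2, hC2 (le_max_right n m) h4⟩⟩
  · intro n
    have hcl : IsClopen (A (n + 1) ×ˢ (Set.univ : Set Ordinal.{0})) := (hA1 _).prod isClopen_univ
    suffices h : ∃ B, Emb ((Iic α ×ˢ Iic β) ∩ (A (n + 1) ×ˢ C (n + 1))ᶜ) B by
      obtain ⟨B, hB⟩ := h
      exact ⟨B, hB.mono fun p hp => ⟨hp.1.1, hp.2⟩⟩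
    have h1 : ∃ B, Emb ((Iic α ×ˢ Iic β) ∩ (A (n + 1) ×ˢ C (n + 1))ᶜ ∩ (A (n + 1) ×ˢ Set.univ)) B := by
      rcases hC6 (n + 1) with h | ⟨β', hβ', h⟩
      · refine hempty _ (Set.eq_empty_of_forall_notMem ?_)
        rintro ⟨x, y⟩ ⟨⟨⟨h1, h2⟩, h3⟩, h4, -⟩
        exact (h ▸ (⟨h2, fun h5 => h3 ⟨h4, h5⟩⟩ : y ∈ Iic β ∩ (C (n + 1))ᶜ) : y ∈ (∅ : Set _))
      · obtain ⟨B, hB⟩ := ihβ β' hβ' (hβ'.trans hβ)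
        refine ⟨B, hB.mono ?_⟩
        rintro ⟨x, y⟩ ⟨⟨⟨h1, h2⟩, h3⟩, h4, -⟩
        exact ⟨h1, h fun h5 => h3 ⟨h4, h5⟩⟩
    have h2 : ∃ B, Emb ((Iic α ×ˢ Iic β) ∩ (A (n + 1) ×ˢ C (n + 1))ᶜ ∩ (A (n + 1) ×ˢ Set.univ)ᶜ) B := by
      rcases hA6 (n + 1) with h | ⟨α', hα', h⟩
      · refine hempty _ (Set.eq_empty_of_forall_notMem ?_)
        rintro ⟨x, y⟩ ⟨⟨⟨h1, h2⟩, h3⟩, h4⟩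
        exact (h ▸ (⟨h1, fun h5 => h4 ⟨h5, Set.mem_univ _⟩⟩ : x ∈ Iic α ∩ (A (n + 1))ᶜ) : x ∈ (∅ : Set _))
      · obtain ⟨B, hB⟩ := ihα α' hα' (hα'.trans hα) β hβ
        refine ⟨B, hB.mono ?_⟩
        rintro ⟨x, y⟩ ⟨⟨⟨h1, h2⟩, h3⟩, h4⟩
        exact ⟨h fun h5 => h4 ⟨h5, Set.mem_univ _⟩, h2⟩
    obtain ⟨B, hB⟩ := h1
    obtain ⟨B', hB'⟩ := h2
    exact ⟨_, Emb.of_clopen hcl hB hB'⟩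

/-- Compact subsets of a countable rectangle are homeomorphic to ordinals of bounded size. -/
theorem exists_bound_rectangle {γ : Ordinal.{0}} (hγ : γ < ω₁) : ∃ B < (ω₁ : Ordinal.{0}),
    ∀ L : Set (Ordinal.{0} × Ordinal.{0}), IsCompact L → L ⊆ Iic γ ×ˢ Iic γ → L = ∅ ∨
      ∃ β < B, SetHomeo L (Iic β) := by
  have key : ∀ (h : Ordinal.{0} × Ordinal.{0} → Ordinal.{0}) (L : Set (Ordinal.{0} × Ordinal.{0})),
      IsCompact L → ContinuousOn h L → InjOn h L → L.Nonempty →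
      ∃ β, SetHomeo L (Iic β) ∧ ∀ B, (∀ p ∈ L, h p ≤ B) → β ≤ B := by
    intro h L hL hc hi hne
    obtain ⟨e, α, he, hec, hei, heB⟩ := exists_collapse (hL.image_of_continuousOn hc) (hne.image h)
    refine ⟨α, (SetHomeo.image hL hc hi).trans
      (SetHomeo.of_image (hL.image_of_continuousOn hc) hec he.injOn hei), fun B hB => heB B ?_⟩
    rintro _ ⟨p, hp, rfl⟩
    exact hB p hp
  -- The bound `B₀` need not be countable. The whole rectangle is therefore classified first: its
  -- ordinal β is countable because the rectangle is, and an embedding into β + 1 then bounds every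
  -- compact subset uniformly.
  obtain ⟨B₀, h, hc, hi, -⟩ := emb_rectangle γ hγ γ hγ
  have hR : IsCompact (Iic γ ×ˢ Iic γ) := (isCompact_Iic_ordinal γ).prod (isCompact_Iic_ordinal γ)
  obtain ⟨β, hβ, -⟩ := key h _ hR hc hi ⟨(γ, γ), by simp⟩
  have hβ1 : β < ω₁ := lt_omega_one_of_countable_Iic
    (hβ.countable ((countable_Iic_of_lt hγ).prod (countable_Iic_of_lt hγ)))
  obtain ⟨f, hfc, hfi, hf⟩ := hβ.exists_fun
  refine ⟨β + 1, succ_lt_omega_one hβ1, fun L hL hLγ => ?_⟩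
  rcases L.eq_empty_or_nonempty with rfl | hne
  · exact Or.inl rfl
  · right
    obtain ⟨δ, hδ, hδB⟩ := key f L hL (hfc.mono hLγ) (hfi.mono hLγ) hne
    refine ⟨δ, Order.lt_add_one_iff.2 (hδB β fun p hp => ?_), hδ⟩
    have := mem_image_of_mem f (hLγ hp)
    rw [hf] at this
    exact this

/-! ### Absorption of countable pieces -/

/-- Empty, or homeomorphic to a countable successor ordinal. -/
def OrdLike {X : Type*} [TopologicalSpace X] (L : Set X) : Prop :=
  L = ∅ ∨ ∃ β < (ω₁ : Ordinal.{0}), SetHomeo L (Iic β)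

theorem OrdLike.of_subset_rectangle {γ : Ordinal.{0}} (hγ : γ < ω₁)
    {L : Set (Ordinal.{0} × Ordinal.{0})} (hL : IsCompact L) (h : L ⊆ Iic γ ×ˢ Iic γ) :
    OrdLike L := by
  obtain ⟨B, hB, h'⟩ := exists_bound_rectangle hγ
  rcases h' L hL h with h | ⟨β, hβ, h⟩
  · exact Or.inl h
  · exact Or.inr ⟨β, hβ.trans hB, h⟩

theorem OrdLike.isCompact {X : Type*} [TopologicalSpace X] {L : Set X} (h : OrdLike L) :
    IsCompact L := by
  rcases h with rfl | ⟨β, -, h⟩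
  · exact isCompact_empty
  · exact h.symm.isCompact (isCompact_Iic_ordinal β)

theorem OrdLike.union {Z : Type*} [TopologicalSpace Z] [T2Space Z] {L K : Set Z} (hL : OrdLike L)
    (hK : OrdLike K) (hd : Disjoint L K) : OrdLike (L ∪ K) := by
  have hLc := hL.isCompact
  have hKc := hK.isCompact
  rcases hL with rfl | ⟨β, hβ, hL⟩
  · rwa [empty_union]
  rcases hK with rfl | ⟨η, hη, hK⟩
  · rw [union_empty]; exact Or.inr ⟨β, hβ, hL⟩
  exact Or.inr ⟨_, add_lt_omega_one (succ_lt_omega_one hβ) hη, hL.union_Iic hLc hKc hd hK⟩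

/-- Since η is additively principal, β + 1 + η = η for every β < η. -/
theorem SetHomeo.union_of_absorb {Z : Type*} [TopologicalSpace Z] [T2Space Z] {L K : Set Z}
    {η : Ordinal.{0}} (hη : IsPrincipal (· + ·) η) (hη1 : 1 < η)
    (hL : L = ∅ ∨ ∃ β < η, SetHomeo L (Iic β)) (hK : SetHomeo K (Iic η)) (hd : Disjoint L K) :
    SetHomeo (L ∪ K) (Iic η) := by
  rcases hL with rfl | ⟨β, hβ, hL⟩
  · rwa [empty_union]
  · have h : β + 1 + η = η := hη.add_eq_right (hη hβ hη1)
    have := hL.union_Iic (hL.symm.isCompact (isCompact_Iic_ordinal β))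
      (hK.symm.isCompact (isCompact_Iic_ordinal η)) hd hK
    rwa [h] at this

/-- Countable ordinal-like clopen parts are absorbed by a clopen copy of `ω₁ + 1`. -/
theorem SetHomeo.absorb {Z : Type*} [TopologicalSpace Z] [T2Space Z] {M K L L' : Set Z}
    (hM : IsCompact M) (hK : SetHomeo K (Iic (ω₁ : Ordinal.{0}))) (hL : OrdLike L)
    (hL' : OrdLike L') (hMK : Disjoint M K) (hML : Disjoint M L) (hML' : Disjoint M L')
    (hLK : Disjoint L K) (hLK' : Disjoint L' K) : SetHomeo (M ∪ (L ∪ K)) (M ∪ (L' ∪ K)) := by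
  have hKc : IsCompact K := hK.symm.isCompact (isCompact_Iic_ordinal _)
  have h1 : ∀ {L : Set Z}, OrdLike L → Disjoint L K → SetHomeo (L ∪ K) (Iic (ω₁ : Ordinal.{0})) := by
    intro L hL hd
    exact SetHomeo.union_of_absorb (isPrincipal_add_omega 1)
      (by simpa using succ_lt_omega_one (omega_pos 1)) hL hK hd
  have hP : IsCompact (L ∪ K) := hL.isCompact.union hKc
  have hd : Disjoint M (L ∪ K) := by simp [hML, hMK]
  have hd' : Disjoint M (L' ∪ K) := by simp [hML', hMK]
  refine SetHomeo.glue (ι := Unit) (M := M) (P := fun _ => L ∪ K) (Q := fun _ => L' ∪ K)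
    (hM.union hP) (by simp [iUnion_const]) (by simp [iUnion_const])
    (fun _ _ _ _ _ => rfl) (fun _ _ _ _ _ => rfl) (fun _ z hz => hd.notMem_of_mem_left hz)
    (fun _ z hz => hd'.notMem_of_mem_left hz) ?_ (fun _ => (h1 hL hLK).trans (h1 hL' hLK').symm) ?_
  · intro _ z hz
    have : Mᶜ ∈ 𝓝 z := hM.isClosed.isOpen_compl.mem_nhds (hd.notMem_of_mem_right hz)
    filter_upwards [self_mem_nhdsWithin, mem_nhdsWithin_of_mem_nhds this] with q hq hqM
    exact hq.resolve_left hqM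
  · intro z hz W _
    filter_upwards [hP.isClosed.isOpen_compl.mem_nhds (hd.notMem_of_mem_left hz)] with q hq _ hq'
    exact absurd hq' hq

/-! ### Fast-growing enumerations of clubs -/

/-- A continuous increasing enumeration of a closed unbounded subset of `ω₁` which is sparse with
respect to a growth condition `φ` at successor steps. -/
structure Adapted (φ : Ordinal.{0} → Ordinal.{0} → Prop) (d : Ordinal.{0} → Ordinal.{0}) : Prop where
  normal : IsNormal d
  zero : d 0 = 0
  principal : ∀ ξ, IsPrincipal (· + ·) (d (ξ + 1))
  one_lt : ∀ ξ, 1 < d (ξ + 1)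
  lt : ∀ ξ < ω₁, d ξ < ω₁
  growth : ∀ ξ < ω₁, φ (d ξ) (d (ξ + 1))

theorem lt_omega_one_iff_card {α : Ordinal.{0}} : α < ω₁ ↔ α.card ≤ ℵ₀ := by
  rw [← Order.lt_succ_iff, Cardinal.succ_aleph0, ← Cardinal.lt_ord, Cardinal.ord_aleph]

theorem exists_adapted {φ : Ordinal.{0} → Ordinal.{0} → Prop}
    (h : ∀ y < ω₁, ∃ β < ω₁, φ y β) (hφ : ∀ y β β', β ≤ β' → φ y β → φ y β') :
    ∃ d, Adapted φ d := by
  choose! θ hθ hθφ using h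
  -- A power of ω is additively principal and at least its exponent, so the two entries of the
  -- maximum yield strict growth and the condition φ.
  let step : Ordinal.{0} → Ordinal.{0} := fun y => ω ^ (max (y + 1) (θ y))
  have hstep1 : ∀ y, y < step y := fun y =>
    (Order.lt_add_one_iff.2 le_rfl).trans_le
      ((le_max_left _ _).trans (Ordinal.right_le_opow _ one_lt_omega0))
  have hstep2 : ∀ y < ω₁, φ y (step y) := fun y hy =>
    hφ y _ _ ((le_max_right _ _).trans (Ordinal.right_le_opow _ one_lt_omega0)) (hθφ y hy)
  have hstep3 : ∀ y < ω₁, step y < ω₁ := by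
    intro y hy
    rw [lt_omega_one_iff_card]
    refine (Ordinal.card_opow_le _ _).trans (max_le le_rfl (max_le (by simp) ?_))
    exact lt_omega_one_iff_card.1 (max_lt (succ_lt_omega_one hy) (hθ y hy))
  let d : Ordinal.{0} → Ordinal.{0} := fun ξ =>
    Ordinal.limitRecOn ξ 0 (fun _ y => step y) (fun l _ f => ⨆ i : Iio l, f i.1 i.2)
  have hd0 : d 0 = 0 := Ordinal.limitRecOn_zero _ _ _
  have hds : ∀ ξ, d (ξ + 1) = step (d ξ) := fun ξ => Ordinal.limitRecOn_add_one _ _ _ _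
  have hdl : ∀ l, IsSuccLimit l → d l = ⨆ i : Iio l, d i.1 := fun l hl =>
    Ordinal.limitRecOn_limit _ _ _ _ hl
  have hn : IsNormal d := by
    refine IsNormal.of_succ_lt (fun a => ?_) (fun {a} ha => ?_)
    · rw [Order.succ_eq_add_one, hds]; exact hstep1 _
    · have : Nonempty (Iio a) := ⟨⟨0, pos_iff_ne_zero.2 ha.ne_bot⟩⟩
      rw [hdl a ha, image_eq_range]
      exact isLUB_ciSup bddAbove_of_small
  have hlt : ∀ ξ < ω₁, d ξ < ω₁ := by
    intro ξ hξ
    induction ξ using Ordinal.limitRecOn with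
    | zero => rw [hd0]; exact omega_pos 1
    | add_one ξ ih =>
      rw [hds]
      exact hstep3 _ (ih ((Order.lt_add_one_iff.2 le_rfl).trans hξ))
    | limit ξ hl ih =>
      rw [hdl ξ hl]
      have := (countable_Iio_iff_lt_omega_one.2 hξ).to_subtype
      exact Ordinal.iSup_lt_omega_one fun i => ih i.1 i.2 (lt_trans i.2 hξ)
  refine ⟨d, hn, hd0, fun ξ => ?_, fun ξ => ?_, hlt, fun ξ hξ => ?_⟩
  · rw [hds]; exact isPrincipal_add_omega0_opow _
  · rw [hds]
    refine one_lt_omega0.trans_le ?_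
    have : (1 : Ordinal.{0}) ≤ max (d ξ + 1) (θ (d ξ)) := le_max_of_le_left le_add_self
    simpa using Ordinal.opow_le_opow_right omega0_pos this
  · rw [hds]; exact hstep2 _ (hlt ξ hξ)

/-- Zero or a limit ordinal. -/
def LimZero (l : Ordinal.{0}) : Prop := ∀ ξ < l, ξ + 1 < l

theorem limZero_omega_one : LimZero ω₁ := fun _ h => succ_lt_omega_one h

namespace Adapted

variable {φ : Ordinal.{0} → Ordinal.{0} → Prop} {d : Ordinal.{0} → Ordinal.{0}}

theorem exists_lt (hd : Adapted φ d) {l b : Ordinal.{0}} (hl : LimZero l) (hb : b < d l) :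
    ∃ ξ < l, b < d ξ := by
  rcases eq_or_ne l 0 with rfl | h0
  · rw [hd.zero] at hb; exact absurd hb not_lt_zero
  · have : IsSuccLimit l := by
      rw [Ordinal.isSuccLimit_iff]
      exact ⟨h0, Order.isSuccPrelimit_of_succ_lt fun a ha => by
        rw [Order.succ_eq_add_one]; exact hl a ha⟩
    exact (hd.normal.lt_iff_exists_lt this).1 hb

theorem omega_one (hd : Adapted φ d) : d ω₁ = ω₁ := by
  refine le_antisymm ?_ hd.normal.strictMono.le_apply
  by_contra! h
  obtain ⟨ξ, h1, h2⟩ := hd.exists_lt limZero_omega_one h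
  exact lt_asymm h2 (hd.lt ξ h1)

theorem lt_iff (hd : Adapted φ d) {a b : Ordinal.{0}} : d a < d b ↔ a < b :=
  hd.normal.strictMono.lt_iff_lt

theorem le_iff (hd : Adapted φ d) {a b : Ordinal.{0}} : d a ≤ d b ↔ a ≤ b :=
  hd.normal.strictMono.le_iff_le

theorem le_omega_one (hd : Adapted φ d) {l : Ordinal.{0}} (hl : l ≤ ω₁) : d l ≤ ω₁ := by
  exact (hd.le_iff.2 hl).trans_eq hd.omega_one

/-- Take the least η with y ≤ d η. By continuity y = d η when η is zero or a limit; otherwise y lies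
in a block (d ξ, d (ξ + 1)]. The values of d at successors thus belong to blocks, and only those at
zero and limits are left over. -/
theorem exists_index (hd : Adapted φ d) {y : Ordinal.{0}} (hy : y ≤ ω₁) :
    (∃ l ≤ ω₁, LimZero l ∧ y = d l) ∨ ∃ ξ < ω₁, d ξ < y ∧ y ≤ d (ξ + 1) := by
  have hex : ∃ η, y ≤ d η := ⟨y, hd.normal.strictMono.le_apply⟩
  obtain ⟨η, hη, hmin⟩ := WellFounded.has_min (wellFounded_lt (α := Ordinal.{0})) {η | y ≤ d η} hex
  have hmin' : ∀ ξ < η, d ξ < y := fun ξ hξ => not_le.1 fun h => hmin ξ h hξ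
  have hη1 : η ≤ ω₁ := by
    by_contra! h
    have := hmin' _ h
    rw [hd.omega_one] at this
    exact absurd hy (not_le.2 this)
  by_cases hl : LimZero η
  · left
    refine ⟨η, hη1, hl, le_antisymm hη ?_⟩
    by_contra! h
    obtain ⟨ξ, h1, h2⟩ := hd.exists_lt hl h
    exact lt_asymm h2 (hmin' ξ h1)
  · right
    simp only [LimZero, not_forall, not_lt] at hl
    obtain ⟨ξ, h1, h2⟩ := hl
    have : η = ξ + 1 := le_antisymm h2 (Order.add_one_le_iff.2 h1)
    exact ⟨ξ, h1.trans_le hη1, hmin' ξ h1, this ▸ hη⟩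

theorem block_unique (hd : Adapted φ d) {y ξ η : Ordinal.{0}} (h1 : d ξ < y) (h2 : y ≤ d (ξ + 1))
    (h3 : d η < y) (h4 : y ≤ d (η + 1)) : ξ = η := by
  have h5 := hd.lt_iff.1 (h1.trans_le h4)
  have h6 := hd.lt_iff.1 (h3.trans_le h2)
  exact le_antisymm (Order.lt_add_one_iff.1 h5) (Order.lt_add_one_iff.1 h6)

theorem not_block (hd : Adapted φ d) {l ξ : Ordinal.{0}} (hl : LimZero l) (h1 : d ξ < d l)
    (h2 : d l ≤ d (ξ + 1)) : False :=
  absurd (hd.le_iff.1 h2) (not_le.2 (hl ξ (hd.lt_iff.1 h1)))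

theorem lt_succ (hd : Adapted φ d) (ξ : Ordinal.{0}) : d ξ < d (ξ + 1) :=
  hd.lt_iff.2 (Order.lt_add_one_iff.2 le_rfl)

theorem mono {ψ : Ordinal.{0} → Ordinal.{0} → Prop} (hd : Adapted φ d)
    (h : ∀ y β, φ y β → ψ y β) : Adapted ψ d :=
  ⟨hd.normal, hd.zero, hd.principal, hd.one_lt, hd.lt, fun ξ hξ => h _ _ (hd.growth ξ hξ)⟩

end Adapted

/-! ### Staircases -/

/-- `β` bounds the sizes of the compact subsets of the square of side `y`. -/
def RectBound (y β : Ordinal.{0}) : Prop :=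
  ∀ L : Set (Ordinal.{0} × Ordinal.{0}), IsCompact L → L ⊆ Iic y ×ˢ Iic y →
    L = ∅ ∨ ∃ δ < β, SetHomeo L (Iic δ)

theorem RectBound.mono {y β β' : Ordinal.{0}} (h : RectBound y β) (hβ : β ≤ β') :
    RectBound y β' := fun L hL hLy =>
  (h L hL hLy).imp_right fun ⟨δ, hδ, h⟩ => ⟨δ, hδ.trans_le hβ, h⟩

/-- In a compact subset of the square, a point over `ω₁` is missed uniformly. -/
theorem exists_bound_snd {S : Set (Ordinal.{0} × Ordinal.{0})} (hS : IsCompact S)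
    (hsub : S ⊆ Iic ω₁ ×ˢ Iic ω₁) (h : ∀ x, (x, ω₁) ∉ S) : ∃ β < ω₁, ∀ p ∈ S, p.2 < β := by
  rcases S.eq_empty_or_nonempty with rfl | hne
  · exact ⟨0, omega_pos 1, by simp⟩
  · obtain ⟨p, hp, hmax⟩ := hS.exists_isMaxOn hne continuous_snd.continuousOn
    have hp1 : p.2 < ω₁ := lt_of_le_of_ne (hsub hp).2 fun h' => h p.1 (h' ▸ hp)
    exact ⟨p.2 + 1, succ_lt_omega_one hp1, fun q hq => Order.lt_add_one_iff.2 (hmax hq)⟩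

theorem exists_bound_fst {S : Set (Ordinal.{0} × Ordinal.{0})} (hS : IsCompact S)
    (hsub : S ⊆ Iic ω₁ ×ˢ Iic ω₁) (h : ∀ y, (ω₁, y) ∉ S) : ∃ β < ω₁, ∀ p ∈ S, p.1 < β := by
  rcases S.eq_empty_or_nonempty with rfl | hne
  · exact ⟨0, omega_pos 1, by simp⟩
  · obtain ⟨p, hp, hmax⟩ := hS.exists_isMaxOn hne continuous_fst.continuousOn
    have hp1 : p.1 < ω₁ := lt_of_le_of_ne (hsub hp).1 fun h' => h p.2 (h' ▸ hp)
    exact ⟨p.1 + 1, succ_lt_omega_one hp1, fun q hq => Order.lt_add_one_iff.2 (hmax hq)⟩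

/-- The region under a cofinal step function `ω₁ → ω₁`. -/
structure Stair (S : Set (Ordinal.{0} × Ordinal.{0})) : Prop where
  compact : IsCompact S
  sub : S ⊆ Iic ω₁ ×ˢ Iic ω₁
  up : ∀ u v u' v', (u, v) ∈ S → u ≤ u' → u' ≤ ω₁ → v' ≤ v → (u', v') ∈ S
  bot : ∀ u ≤ ω₁, (u, 0) ∈ S
  top : ∀ u, (u, ω₁) ∈ S → u = ω₁
  cof : ∀ y < ω₁, ∃ x < ω₁, (x, y) ∈ S

/-- The growth condition for enumerations adapted to a staircase. -/
def StairGrowth (S : Set (Ordinal.{0} × Ordinal.{0})) (y β : Ordinal.{0}) : Prop :=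
  (∀ x y', x ≤ y → (x, y') ∈ S → y' < β) ∧ (∃ x ≤ β, (x, y) ∈ S) ∧ RectBound y β

theorem StairGrowth.mono {S : Set (Ordinal.{0} × Ordinal.{0})} {y β β' : Ordinal.{0}}
    (h : β ≤ β') (hS : StairGrowth S y β) : StairGrowth S y β' :=
  ⟨fun x y' hx hp => (hS.1 x y' hx hp).trans_le h,
    hS.2.1.imp fun _ hx => ⟨hx.1.trans h, hx.2⟩, hS.2.2.mono h⟩

/-- Over the columns up to y, compactness and `top` keep the heights below ω₁; `cof` supplies a
column reaching row y; the last bound is that for countable squares. -/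
theorem Stair.growth {S : Set (Ordinal.{0} × Ordinal.{0})} (hS : Stair S) (y : Ordinal.{0})
    (hy : y < ω₁) : ∃ β < ω₁, StairGrowth S y β := by
  obtain ⟨β₁, h1, h1'⟩ := exists_bound_snd (S := S ∩ Prod.fst ⁻¹' Iic y)
    (hS.compact.inter_right (isClosed_Iic.preimage continuous_fst))
    (inter_subset_left.trans hS.sub) (fun x hx => absurd (hS.top x hx.1 ▸ hx.2) (not_le.2 hy))
  obtain ⟨x, hx, hxy⟩ := hS.cof y hy
  obtain ⟨β₂, h2, h2'⟩ := exists_bound_rectangle hy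
  refine ⟨max β₁ (max x β₂), max_lt h1 (max_lt hx h2), ?_, ⟨x, by simp, hxy⟩, ?_⟩
  · exact fun x y' hxy hp => (h1' (x, y') ⟨hp, hxy⟩).trans_le (le_max_left _ _)
  · exact RectBound.mono h2' (by simp)

namespace Stair

variable {S S' : Set (Ordinal.{0} × Ordinal.{0})} {d : Ordinal.{0} → Ordinal.{0}}

/-- At limit stages the boundary of every staircase hits the diagonal. Columns left of d l stay
below height d l by the growth condition, while the points reached at earlier stages accumulate at
(d l, d l), which belongs to S because S is closed. -/
theorem mem_limit_iff (hS : Stair S) (hd : Adapted (StairGrowth S) d) {l x : Ordinal.{0}}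
    (hl : LimZero l) (hl1 : l ≤ ω₁) : (x, d l) ∈ S ↔ d l ≤ x ∧ x ≤ ω₁ := by
  constructor
  · intro h
    refine ⟨?_, (hS.sub h).1⟩
    by_contra! hx
    obtain ⟨ξ, h1, h2⟩ := hd.exists_lt hl hx
    have := (hd.growth ξ (h1.trans_le hl1)).1 x _ h2.le h
    exact lt_asymm (hd.lt_iff.1 this) (hl ξ h1)
  · rintro ⟨h1, h2⟩
    suffices h : (d l, d l) ∈ S from hS.up _ _ _ _ h h1 h2 le_rfl
    rcases eq_or_ne l 0 with rfl | h0
    · rw [hd.zero]; exact hS.bot 0 zero_le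
    by_contra hn
    have := hS.compact.isClosed.isOpen_compl.mem_nhds hn
    rw [nhds_prod_eq, Filter.mem_prod_iff] at this
    obtain ⟨U, hU, V, hV, hUV⟩ := this
    have hpos : 0 < d l := hd.zero.symm.trans_lt (hd.lt_iff.2 (pos_iff_ne_zero.2 h0))
    obtain ⟨c, hc, hcV⟩ := exists_Ioc_subset_of_mem_nhds hV ⟨0, hpos⟩
    obtain ⟨ξ, h3, h4⟩ := hd.exists_lt hl hc
    obtain ⟨x', hx', hx'S⟩ := (hd.growth ξ (h3.trans_le hl1)).2.1
    refine hUV (a := (d l, d ξ)) ⟨mem_of_mem_nhds hU, hcV ⟨h4, hd.le_iff.2 h3.le⟩⟩ ?_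
    exact hS.up _ _ _ _ hx'S (hx'.trans (hd.le_iff.2 (hl ξ h3).le)) (hd.le_omega_one hl1) le_rfl

theorem mem_of_lt (hS : Stair S) (hd : Adapted (StairGrowth S) d) {ξ x y : Ordinal.{0}}
    (hξ : ξ < ω₁) (hy : y ≤ d (ξ + 1)) (hx : d (ξ + 1 + 1) < x) (hx1 : x ≤ ω₁) : (x, y) ∈ S := by
  obtain ⟨x', hx', hx'S⟩ := (hd.growth (ξ + 1) (succ_lt_omega_one hξ)).2.1
  exact hS.up _ _ _ _ hx'S (hx'.trans hx.le) hx1 hy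

/-- Points in high rows lie far to the right. This is what makes the near blocks shrink to the
diagonal. -/
theorem lt_fst (hd : Adapted (StairGrowth S) d) {ξ μ x y : Ordinal.{0}}
    (hξ : ξ < ω₁) (hμ : μ < ξ) (hp : (x, y) ∈ S) (hy : d ξ < y) : d μ < x := by
  by_contra! h
  have := (hd.growth μ (hμ.trans hξ)).1 x y h hp
  exact lt_asymm (this.trans_le (hd.le_iff.2 (Order.add_one_le_iff.2 hμ))) hy

end Stair

/-- The part of the `ξ`-th block of rows near the diagonal, together with a line. -/
def nearBlock (d : Ordinal.{0} → Ordinal.{0}) (ξ : Ordinal.{0}) : Set (Ordinal.{0} × Ordinal.{0}) :=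
  (Prod.snd ⁻¹' (Ioi (d ξ) ∩ Iic (d (ξ + 1)))) ∩
    (Prod.fst ⁻¹' Iic (d (ξ + 1 + 1)) ∪
      (Prod.snd ⁻¹' Iic (d ξ + 1) ∩ Prod.fst ⁻¹' Iic (d (ξ + 1 + 1 + 1))))

theorem isClopen_nearBlock (d : Ordinal.{0} → Ordinal.{0}) (ξ : Ordinal.{0}) :
    IsClopen (nearBlock d ξ) := by
  have h1 : ∀ a : Ordinal.{0}, IsClopen (Prod.fst ⁻¹' Iic a : Set (Ordinal.{0} × Ordinal.{0})) :=
    fun a => (isClopen_Iic_ordinal a).preimage continuous_fst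
  have h2 : ∀ a : Ordinal.{0}, IsClopen (Prod.snd ⁻¹' Iic a : Set (Ordinal.{0} × Ordinal.{0})) :=
    fun a => (isClopen_Iic_ordinal a).preimage continuous_snd
  exact (((isClopen_Ioi_ordinal _).inter (isClopen_Iic_ordinal _)).preimage continuous_snd).inter
    ((h1 _).union ((h2 _).inter (h1 _)))

namespace Stair

variable {S S' : Set (Ordinal.{0} × Ordinal.{0})} {d : Ordinal.{0} → Ordinal.{0}}

/-- The resulting type does not depend on S. The part L with x ≤ d (ξ + 2) lies in a square of side
d (ξ + 2), so it is smaller than d (ξ + 3); the added segment K of the lowest row, of length d (ξ +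
3), absorbs it. -/
theorem inter_nearBlock (hS : Stair S) (hd : Adapted (StairGrowth S) d) {ξ : Ordinal.{0}}
    (hξ : ξ < ω₁) : SetHomeo (S ∩ nearBlock d ξ) (Iic (d (ξ + 1 + 1 + 1))) := by
  set K : Set (Ordinal.{0} × Ordinal.{0}) :=
    Icc (d (ξ + 1 + 1) + 1) (d (ξ + 1 + 1 + 1)) ×ˢ {d ξ + 1} with hK
  set L : Set (Ordinal.{0} × Ordinal.{0}) :=
    S ∩ (Prod.snd ⁻¹' (Ioi (d ξ) ∩ Iic (d (ξ + 1))) ∩ Prod.fst ⁻¹' Iic (d (ξ + 1 + 1))) with hL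
  have hξ2 : ξ + 1 + 1 < ω₁ := succ_lt_omega_one (succ_lt_omega_one hξ)
  have hξ3 := succ_lt_omega_one hξ2
  have hle : d ξ + 1 ≤ d (ξ + 1) := Order.add_one_le_iff.2 (hd.lt_succ ξ)
  have heq : S ∩ nearBlock d ξ = L ∪ K := by
    ext ⟨x, y⟩
    simp only [nearBlock, hL, hK, mem_inter_iff, mem_union, mem_preimage, mem_Ioi, mem_Iic, mem_prod,
      mem_Icc, mem_singleton_iff]
    constructor
    · rintro ⟨h1, ⟨h2, h3⟩, h4⟩
      rcases le_or_gt x (d (ξ + 1 + 1)) with h5 | h5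
      · exact Or.inl ⟨h1, ⟨h2, h3⟩, h5⟩
      · rcases h4 with h4 | ⟨h4, h6⟩
        · exact absurd h4 (not_le.2 h5)
        · exact Or.inr ⟨⟨Order.add_one_le_iff.2 h5, h6⟩, le_antisymm h4 (Order.add_one_le_iff.2 h2)⟩
    · rintro (⟨h1, h2, h3⟩ | ⟨⟨h1, h2⟩, rfl⟩)
      · exact ⟨h1, h2, Or.inl h3⟩
      · exact ⟨hS.mem_of_lt hd hξ hle (Order.add_one_le_iff.1 h1)
          (h2.trans (hd.le_omega_one hξ3.le)), ⟨Order.lt_add_one_iff.2 le_rfl, hle⟩,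
          Or.inr ⟨le_rfl, h2⟩⟩
  rw [heq]
  refine SetHomeo.union_of_absorb (hd.principal _) (hd.one_lt _) ?_ ?_ ?_
  · refine (hd.growth _ hξ2).2.2 L (hS.compact.inter_right ?_) ?_
    · exact (((isClopen_Ioi_ordinal _).isClosed.inter isClosed_Iic).preimage continuous_snd).inter
        (isClosed_Iic.preimage continuous_fst)
    · rintro ⟨x, y⟩ ⟨-, ⟨-, h2⟩, h3⟩
      exact ⟨h3, le_trans h2 (hd.lt_succ _).le⟩
  · refine SetHomeo.trans (T := Icc (d (ξ + 1 + 1) + 1) (d (ξ + 1 + 1 + 1))) ?_ (setHomeo_Icc ?_)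
    · refine SetHomeo.of_image (isCompact_Icc.prod isCompact_singleton)
        continuous_fst.continuousOn ?_ ?_
      · rintro ⟨x, y⟩ ⟨-, h1⟩ ⟨x', y'⟩ ⟨-, h2⟩ h
        exact Prod.ext h (h1.trans h2.symm)
      · exact fst_image_prod _ (singleton_nonempty _)
    · exact (hd.principal _).add_eq_right ((hd.principal _) (hd.lt_succ _) (hd.one_lt _))
  · rw [Set.disjoint_left]
    rintro ⟨x, y⟩ ⟨-, -, h3⟩ ⟨⟨h4, -⟩, -⟩
    exact absurd h3 (not_le.2 (Order.add_one_le_iff.1 h4))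

/-- Away from the near blocks, membership is dictated by d alone: limit rows start at the diagonal,
and rows of block ξ are full beyond d (ξ + 2). Two staircases adapted to the same d therefore agree
there. -/
theorem far_subset (hS : Stair S) (hd : Adapted (StairGrowth S) d) (hS' : Stair S')
    (hd' : Adapted (StairGrowth S') d) {p : Ordinal.{0} × Ordinal.{0}} (hp : p ∈ S)
    (hfar : ∀ ξ < ω₁, p ∉ nearBlock d ξ) : p ∈ S' := by
  obtain ⟨x, y⟩ := p
  rcases hd.exists_index (hS.sub hp).2 with ⟨l, hl1, hl, h⟩ | ⟨ξ, hξ, h1, h2⟩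
  · simp only at h
    subst h
    exact (hS'.mem_limit_iff hd' hl hl1).2 ((hS.mem_limit_iff hd hl hl1).1 hp)
  · refine hS'.mem_of_lt hd' hξ h2 ?_ (hS.sub hp).1
    by_contra! h
    exact hfar ξ hξ ⟨⟨h1, h2⟩, Or.inl h⟩

theorem setHomeo_of_adapted (hS : Stair S) (hd : Adapted (StairGrowth S) d) (hS' : Stair S')
    (hd' : Adapted (StairGrowth S') d) : SetHomeo S S' := by
  let M := {p | p ∈ S ∧ ∀ ξ < ω₁, p ∉ nearBlock d ξ}
  have hM' : ∀ p, p ∈ M ↔ p ∈ S' ∧ ∀ ξ < ω₁, p ∉ nearBlock d ξ := fun p =>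
    ⟨fun h => ⟨hS.far_subset hd hS' hd' h.1 h.2, h.2⟩,
      fun h => ⟨hS'.far_subset hd' hS hd h.1 h.2, h.2⟩⟩
  have huniq : ∀ ξ η p, p ∈ nearBlock d ξ → p ∈ nearBlock d η → ξ = η := fun ξ η p h1 h2 =>
    hd.block_unique h1.1.1 h1.1.2 h2.1.1 h2.1.2
  refine SetHomeo.glue (ι := Iio (ω₁ : Ordinal.{0})) (M := M) (P := fun ξ => S ∩ nearBlock d ξ)
    (Q := fun ξ => S' ∩ nearBlock d ξ) hS.compact ?_ ?_ (fun i j z hi hj => Subtype.ext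
      (huniq _ _ z hi.2 hj.2)) (fun i j z hi hj => Subtype.ext (huniq _ _ z hi.2 hj.2))
    (fun i z hz h => hz.2 i i.2 h.2) (fun i z hz h => hz.2 i i.2 h.2) ?_
    (fun i => (hS.inter_nearBlock hd i.2).trans (hS'.inter_nearBlock hd' i.2).symm) ?_
  · ext p
    simp only [M, mem_union, mem_iUnion, mem_inter_iff, mem_ofPred_eq, Subtype.exists, mem_Iio]
    by_cases h : ∃ ξ, ∃ _ : ξ < ω₁, p ∈ nearBlock d ξ
    · obtain ⟨ξ, hξ, h⟩ := h
      exact ⟨fun hp => Or.inr ⟨ξ, hξ, hp, h⟩, fun hp => hp.elim (·.1) fun ⟨_, _, h⟩ => h.1⟩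
    · push Not at h
      exact ⟨fun hp => Or.inl ⟨hp, h⟩, fun hp => hp.elim (·.1) fun ⟨_, _, h⟩ => h.1⟩
  · ext p
    simp only [mem_union, hM', mem_iUnion, mem_inter_iff, Subtype.exists, mem_Iio]
    by_cases h : ∃ ξ, ∃ _ : ξ < ω₁, p ∈ nearBlock d ξ
    · obtain ⟨ξ, hξ, h⟩ := h
      exact ⟨fun hp => Or.inr ⟨ξ, hξ, hp, h⟩, fun hp => hp.elim (·.1) fun ⟨_, _, h⟩ => h.1⟩
    · push Not at h
      exact ⟨fun hp => Or.inl ⟨hp, h⟩, fun hp => hp.elim (·.1) fun ⟨_, _, h⟩ => h.1⟩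
  · intro i z hz
    exact inter_mem self_mem_nhdsWithin
      (mem_nhdsWithin_of_mem_nhds ((isClopen_nearBlock d i).isOpen.mem_nhds hz.2))
  · rintro ⟨x, y⟩ hz W hW
    have hxy : x ≤ ω₁ ∧ y ≤ ω₁ := hS.sub hz.1
    rcases hd.exists_index hxy.2 with ⟨l, hl1, hl, h⟩ | ⟨ξ, hξ, h1, h2⟩
    · subst h
      have hx := ((hS.mem_limit_iff hd hl hl1).1 hz.1).1
      have hrow : ∀ᶠ q in 𝓝 ((x, d l) : Ordinal.{0} × Ordinal.{0}), q.2 ≤ d l :=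
        continuous_snd.continuousAt.eventually ((isClopen_Iic_ordinal (d l)).isOpen.mem_nhds
          (le_refl (d l)))
      -- Strictly right of the diagonal in a limit row, nearby points avoid all near blocks: those
      -- of rows below d l end at or before column d l. At the diagonal point itself, the blocks
      -- converge to it.
      rcases hx.lt_or_eq with hlt | heq
      · have hcol : ∀ᶠ q in 𝓝 ((x, d l) : Ordinal.{0} × Ordinal.{0}), d l < q.1 :=
          continuous_fst.continuousAt.eventually (isOpen_Ioi.mem_nhds hlt)
        filter_upwards [hrow, hcol] with q hq1 hq2 i hqi
        have h3 : i.1 < l := hd.lt_iff.1 (lt_of_lt_of_le hqi.2.1.1 hq1)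
        have h4 := hl _ (hl _ (hl _ h3))
        have h5 : q.1 ≤ d (i + 1 + 1 + 1) := by
          rcases hqi.2.2 with h | h
          · exact le_trans h (hd.lt_succ _).le
          · exact h.2
        exact absurd (hq2.trans_le h5) (not_lt.2 (hd.le_iff.2 h4.le))
      · subst heq
        rcases eq_or_ne l 0 with rfl | h0
        · filter_upwards [hrow] with q hq i hqi
          have := lt_of_lt_of_le hqi.2.1.1 hq
          rw [hd.zero] at this
          exact absurd this not_lt_zero
        · have hpos : 0 < d l := hd.zero.symm.trans_lt (hd.lt_iff.2 (pos_iff_ne_zero.2 h0))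
          rw [nhds_prod_eq, Filter.mem_prod_iff] at hW
          obtain ⟨U, hU, V, hV, hUV⟩ := hW
          obtain ⟨c, hc, hcU⟩ := exists_Ioc_subset_of_mem_nhds hU ⟨0, hpos⟩
          obtain ⟨c', hc', hcV⟩ := exists_Ioc_subset_of_mem_nhds hV ⟨0, hpos⟩
          obtain ⟨μ, h3, h4⟩ := hd.exists_lt hl (max_lt hc hc')
          have hrow' : ∀ᶠ q in 𝓝 ((d l, d l) : Ordinal.{0} × Ordinal.{0}), d (μ + 1) < q.2 :=
            continuous_snd.continuousAt.eventually
              (isOpen_Ioi.mem_nhds (hd.lt_iff.2 (hl μ h3)))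
          filter_upwards [hrow, hrow'] with q hq1 hq2 i hqi
          have h5 : i.1 < l := hd.lt_iff.1 (lt_of_lt_of_le hqi.2.1.1 hq1)
          have h6 := hl _ (hl _ (hl _ h5))
          have h7 : μ + 1 ≤ i.1 := Order.lt_add_one_iff.1 (hd.lt_iff.1 (lt_of_lt_of_le hq2 hqi.2.1.2))
          rintro ⟨a, b⟩ ⟨hab, hn⟩
          have hμ : d μ < a := lt_fst hd' i.2 (Order.add_one_le_iff.1 h7) hab hn.1.1
          have ha : a ≤ d (i + 1 + 1 + 1) := by
            rcases hn.2 with h | h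
            · exact le_trans h (hd.lt_succ _).le
            · exact h.2
          refine hUV ⟨hcU ⟨(lt_of_le_of_lt (le_max_left _ _) h4).trans hμ,
            ha.trans (hd.le_iff.2 h6.le)⟩, hcV ⟨?_, le_trans hn.1.2 (hd.le_iff.2 (hl _ h5).le)⟩⟩
          exact ((le_max_right _ _).trans_lt h4).trans
            (lt_of_le_of_lt (hd.le_iff.2 (Order.add_one_le_iff.1 h7).le) hn.1.1)
    · have hx : d (ξ + 1 + 1) < x := by
        by_contra! h
        exact hz.2 ξ hξ ⟨⟨h1, h2⟩, Or.inl h⟩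
      have hrow : ∀ᶠ q in 𝓝 ((x, y) : Ordinal.{0} × Ordinal.{0}), q.2 ∈ Ioi (d ξ) ∩ Iic (d (ξ + 1)) :=
        continuous_snd.continuousAt.eventually
          ((isOpen_Ioi.inter (isClopen_Iic_ordinal _).isOpen).mem_nhds ⟨h1, h2⟩)
      have hout : ∀ᶠ q in 𝓝 ((x, y) : Ordinal.{0} × Ordinal.{0}), q ∉ nearBlock d ξ :=
        (isClopen_nearBlock d ξ).compl.isOpen.mem_nhds (hz.2 ξ hξ)
      filter_upwards [hrow, hout] with q hq1 hq2 i hqi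
      have : i.1 = ξ := hd.block_unique hqi.2.1.1 hqi.2.1.2 hq1.1 hq1.2
      rw [this] at hqi
      exact absurd hqi.2 hq2

/-- Any two staircases are homeomorphic. -/
theorem setHomeo (hS : Stair S) (hS' : Stair S') : SetHomeo S S' := by
  obtain ⟨d, hd⟩ := exists_adapted (φ := fun y β => StairGrowth S y β ∧ StairGrowth S' y β)
    (fun y hy => by
      obtain ⟨β, h1, h2⟩ := hS.growth y hy
      obtain ⟨β', h1', h2'⟩ := hS'.growth y hy
      exact ⟨max β β', max_lt h1 h1', h2.mono (le_max_left _ _), h2'.mono (le_max_right _ _)⟩)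
    (fun y β β' h hβ => ⟨hβ.1.mono h, hβ.2.mono h⟩)
  exact hS.setHomeo_of_adapted (hd.mono fun _ _ h => h.1) hS' (hd.mono fun _ _ h => h.2)

end Stair

/-! ### Sets pinched at the corner -/

theorem exists_collapse_omega_one {C : Set Ordinal.{0}} (hC : IsCompact C) (hsub : C ⊆ Iic ω₁)
    (hunc : ¬ C.Countable) : ∃ e : Ordinal.{0} → Ordinal.{0}, StrictMonoOn e C ∧ ContinuousOn e C ∧
      e '' C = Iic ω₁ := by
  have hne : C.Nonempty := nonempty_iff_ne_empty.2 fun h => hunc (h ▸ countable_empty)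
  obtain ⟨e, α, h1, h2, h3, h4⟩ := exists_collapse hC hne
  have hα : α = ω₁ := by
    refine le_antisymm (h4 _ hsub) (not_lt.1 fun h => hunc ?_)
    have := (SetHomeo.image hC h2 h1.injOn).symm
    rw [h3] at this
    exact this.countable (countable_Iic_of_lt h)
  exact ⟨e, h1, h2, hα ▸ h3⟩

/-- The growth condition for enumerations adapted to a set pinched at `ω₁`. -/
def PinchGrowth (S : Set (Ordinal.{0} × Ordinal.{0})) (y β : Ordinal.{0}) : Prop :=
  (∀ p ∈ S, p.1 ≤ y → p.2 < β) ∧ (∀ p ∈ S, p.2 ≤ y → p.1 < β) ∧ RectBound y β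

/-- Cut S by the larger coordinate. The growth condition forces the points outside all blocks to be
diagonal points (d l, d l), and each block is a countable compact set that can be moved onto the
diagonal. The result is an uncountable compact subset of a copy of ω₁ + 1, which collapses onto ω₁ +
1. -/
theorem setHomeo_Iic_of_pinched {S : Set (Ordinal.{0} × Ordinal.{0})} (hS : IsCompact S)
    (hsub : S ⊆ Iic ω₁ ×ˢ Iic ω₁) (hunc : ¬ S.Countable) (h1 : ∀ x, (x, ω₁) ∈ S → x = ω₁)
    (h2 : ∀ y, (ω₁, y) ∈ S → y = ω₁) : SetHomeo S (Iic (ω₁ : Ordinal.{0})) := by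
  obtain ⟨d, hd⟩ : ∃ d, Adapted (PinchGrowth S) d := by
    refine exists_adapted (fun y hy => ?_) (fun y β β' h hβ => ⟨fun p hp hpy =>
      (hβ.1 p hp hpy).trans_le h, fun p hp hpy => (hβ.2.1 p hp hpy).trans_le h, hβ.2.2.mono h⟩)
    obtain ⟨β₁, h3, h3'⟩ := exists_bound_snd (S := S ∩ Prod.fst ⁻¹' Iic y)
      (hS.inter_right (isClosed_Iic.preimage continuous_fst))
      (inter_subset_left.trans hsub) (fun x hx => absurd (h1 x hx.1 ▸ hx.2) (not_le.2 hy))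
    obtain ⟨β₂, h4, h4'⟩ := exists_bound_fst (S := S ∩ Prod.snd ⁻¹' Iic y)
      (hS.inter_right (isClosed_Iic.preimage continuous_snd))
      (inter_subset_left.trans hsub) (fun x hx => absurd (h2 x hx.1 ▸ hx.2) (not_le.2 hy))
    obtain ⟨β₃, h5, h5'⟩ := exists_bound_rectangle hy
    exact ⟨max β₁ (max β₂ β₃), max_lt h3 (max_lt h4 h5),
      fun p hp hpy => (h3' p ⟨hp, hpy⟩).trans_le (by simp),
      fun p hp hpy => (h4' p ⟨hp, hpy⟩).trans_le (by simp), RectBound.mono h5' (by simp)⟩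
  have hmc : Continuous fun p : Ordinal.{0} × Ordinal.{0} => max p.1 p.2 :=
    continuous_fst.max continuous_snd
  let blk : Ordinal.{0} → Set (Ordinal.{0} × Ordinal.{0}) := fun ξ =>
    (fun p => max p.1 p.2) ⁻¹' (Ioi (d ξ) ∩ Iic (d (ξ + 1)))
  have hblk : ∀ ξ, IsClopen (blk ξ) := fun ξ =>
    ((isClopen_Ioi_ordinal _).inter (isClopen_Iic_ordinal _)).preimage hmc
  have huniq : ∀ ξ η p, p ∈ blk ξ → p ∈ blk η → ξ = η := fun ξ η p h1 h2 =>
    hd.block_unique h1.1 h1.2 h2.1 h2.2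
  let M := {p | p ∈ S ∧ ∀ ξ < ω₁, p ∉ blk ξ}
  have hM : ∀ p ∈ M, ∃ l ≤ ω₁, LimZero l ∧ p = (d l, d l) := by
    rintro ⟨x, y⟩ ⟨hp, hn⟩
    have hp' : x ≤ ω₁ ∧ y ≤ ω₁ := hsub hp
    rcases hd.exists_index (max_le hp'.1 hp'.2) with ⟨l, hl1, hl, h⟩ | ⟨ξ, hξ, h3, h4⟩
    · refine ⟨l, hl1, hl, ?_⟩
      rcases le_total x y with hxy | hxy
      · rw [max_eq_right hxy] at h
        subst h
        rcases hxy.lt_or_eq with hlt | rfl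
        · obtain ⟨ξ, h5, h6⟩ := hd.exists_lt hl hlt
          have := (hd.growth ξ (h5.trans_le hl1)).1 _ hp h6.le
          exact absurd (hl ξ h5) (not_lt.2 (hd.lt_iff.1 this).le)
        · rfl
      · rw [max_eq_left hxy] at h
        subst h
        rcases hxy.lt_or_eq with hlt | rfl
        · obtain ⟨ξ, h5, h6⟩ := hd.exists_lt hl hlt
          have := (hd.growth ξ (h5.trans_le hl1)).2.1 _ hp h6.le
          exact absurd (hl ξ h5) (not_lt.2 (hd.lt_iff.1 this).le)
        · rfl
    · exact absurd ⟨h3, h4⟩ (hn ξ hξ)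
  -- The copy goes one block further up: the ordinal of block ξ is below d (ξ + 2), which is
  -- principal, so it fits strictly between d (ξ + 1) and d (ξ + 2). The copies are then disjoint
  -- and miss the limit points.
  have hQ : ∀ ξ : Iio (ω₁ : Ordinal.{0}), ∃ Q : Set (Ordinal.{0} × Ordinal.{0}),
      SetHomeo (S ∩ blk ξ) Q ∧ ∀ p ∈ Q, p.1 = p.2 ∧ d (ξ + 1) < p.1 ∧ p.1 < d (ξ + 1 + 1) := by
    rintro ⟨ξ, hξ⟩
    have hsub' : S ∩ blk ξ ⊆ Iic (d (ξ + 1)) ×ˢ Iic (d (ξ + 1)) := fun p hp =>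
      ⟨(le_max_left p.1 p.2).trans hp.2.2, (le_max_right p.1 p.2).trans hp.2.2⟩
    rcases (hd.growth _ (succ_lt_omega_one hξ)).2.2 _ (hS.inter_right (hblk ξ).isClosed) hsub'
      with h | ⟨β, hβ, h⟩
    · exact ⟨∅, h ▸ SetHomeo.refl _, by simp⟩
    · refine ⟨(fun z => (z, z)) '' Icc (d (ξ + 1) + 1) (d (ξ + 1) + 1 + β), ?_, ?_⟩
      · refine (h.trans (setHomeo_Icc rfl).symm).trans (SetHomeo.image isCompact_Icc ?_ ?_)
        · exact (continuous_id.prodMk continuous_id).continuousOn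
        · intro x _ y _ hxy
          exact congrArg Prod.fst hxy
      · rintro _ ⟨z, hz, rfl⟩
        refine ⟨rfl, Order.add_one_le_iff.1 hz.1, lt_of_le_of_lt hz.2 ?_⟩
        exact hd.principal _ (hd.principal _ (hd.lt_succ _) (hd.one_lt _)) hβ
  choose Q hQ1 hQ2 using hQ
  have hSM : S = M ∪ ⋃ i : Iio (ω₁ : Ordinal.{0}), S ∩ blk i := by
    ext p
    simp only [M, mem_union, mem_iUnion, mem_inter_iff, mem_ofPred_eq, Subtype.exists, mem_Iio]
    by_cases h : ∃ ξ, ∃ _ : ξ < ω₁, p ∈ blk ξ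
    · obtain ⟨ξ, hξ, h⟩ := h
      exact ⟨fun hp => Or.inr ⟨ξ, hξ, hp, h⟩, fun hp => hp.elim (·.1) fun ⟨_, _, h⟩ => h.1⟩
    · push Not at h
      exact ⟨fun hp => Or.inl ⟨hp, h⟩, fun hp => hp.elim (·.1) fun ⟨_, _, h⟩ => h.1⟩
  have hglue : SetHomeo S (M ∪ ⋃ i, Q i) := by
    refine SetHomeo.glue (M := M) (P := fun ξ : Iio (ω₁ : Ordinal.{0}) => S ∩ blk ξ) (Q := Q)
      hS hSM rfl (fun i j z hi hj => Subtype.ext (huniq _ _ z hi.2 hj.2)) ?_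
      (fun i z hz h => hz.2 i i.2 h.2) ?_ ?_ hQ1 ?_
    · intro i j z hi hj
      have h3 := hQ2 i z hi
      have h4 := hQ2 j z hj
      have := hd.block_unique h3.2.1 h3.2.2.le h4.2.1 h4.2.2.le
      exact Subtype.ext (by simpa using this)
    · intro i z hz hzi
      obtain ⟨l, hl1, hl, rfl⟩ := hM z hz
      have h3 := hQ2 i _ hzi
      exact hd.not_block hl h3.2.1 h3.2.2.le
    · intro i z hz
      exact inter_mem self_mem_nhdsWithin
        (mem_nhdsWithin_of_mem_nhds ((hblk i).isOpen.mem_nhds hz.2))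
    · intro z hz W hW
      obtain ⟨l, hl1, hl, rfl⟩ := hM z hz
      have hle : ∀ᶠ q in 𝓝 ((d l, d l) : Ordinal.{0} × Ordinal.{0}), max q.1 q.2 ≤ d l :=
        hmc.continuousAt.eventually ((isClopen_Iic_ordinal (d l)).isOpen.mem_nhds (by simp))
      rcases eq_or_ne l 0 with rfl | h0
      · filter_upwards [hle] with q hq i hqi
        have := lt_of_lt_of_le hqi.2.1 hq
        rw [hd.zero] at this
        exact absurd this not_lt_zero
      · have hpos : 0 < d l := hd.zero.symm.trans_lt (hd.lt_iff.2 (pos_iff_ne_zero.2 h0))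
        rw [nhds_prod_eq, Filter.mem_prod_iff] at hW
        obtain ⟨U, hU, V, hV, hUV⟩ := hW
        obtain ⟨c, hc, hcU⟩ := exists_Ioc_subset_of_mem_nhds hU ⟨0, hpos⟩
        obtain ⟨c', hc', hcV⟩ := exists_Ioc_subset_of_mem_nhds hV ⟨0, hpos⟩
        obtain ⟨μ, h3, h4⟩ := hd.exists_lt hl (max_lt hc hc')
        have hgt : ∀ᶠ q in 𝓝 ((d l, d l) : Ordinal.{0} × Ordinal.{0}), d μ < max q.1 q.2 :=
          hmc.continuousAt.eventually (isOpen_Ioi.mem_nhds (by simpa using hd.lt_iff.2 h3))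
        filter_upwards [hle, hgt] with q hq1 hq2 i hqi
        have h5 : i.1 < l := hd.lt_iff.1 (lt_of_lt_of_le hqi.2.1 hq1)
        have h6 := hl _ (hl _ h5)
        have h7 := lt_of_lt_of_le hq2 hqi.2.2
        rintro ⟨a, b⟩ hab
        obtain ⟨rfl, h8, h9⟩ : a = b ∧ d (i + 1) < a ∧ a < d (i + 1 + 1) := hQ2 i _ hab
        have h10 : max c c' < a := h4.trans (h7.trans h8)
        have h11 : a ≤ d l := h9.le.trans (hd.le_iff.2 h6.le)
        exact hUV ⟨hcU ⟨(le_max_left _ _).trans_lt h10, h11⟩,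
          hcV ⟨(le_max_right _ _).trans_lt h10, h11⟩⟩
  have hYc := hglue.isCompact hS
  have hdiag : ∀ p ∈ M ∪ ⋃ i, Q i, p.1 = p.2 ∧ p.1 ≤ ω₁ := by
    rintro p (hp | hp)
    · obtain ⟨l, hl1, -, rfl⟩ := hM p hp
      exact ⟨rfl, hd.le_omega_one hl1⟩
    · obtain ⟨i, hi⟩ := mem_iUnion.1 hp
      have := hQ2 i p hi
      exact ⟨this.1, this.2.2.le.trans
        (hd.le_omega_one (succ_lt_omega_one (succ_lt_omega_one i.2)).le)⟩
  have hfst : SetHomeo (M ∪ ⋃ i, Q i) (Prod.fst '' (M ∪ ⋃ i, Q i)) := by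
    refine SetHomeo.image hYc continuous_fst.continuousOn fun p hp q hq h => ?_
    exact Prod.ext h ((hdiag p hp).1.symm.trans (h.trans (hdiag q hq).1))
  have hC := hfst.isCompact hYc
  obtain ⟨e, he1, he2, he3⟩ := exists_collapse_omega_one hC
    (by rintro _ ⟨p, hp, rfl⟩; exact (hdiag p hp).2)
    (fun h => hunc ((hglue.trans hfst).symm.countable h))
  exact (hglue.trans hfst).trans (SetHomeo.of_image hC he2 he1.injOn he3)

theorem SetHomeo.union {X Y : Type*} [TopologicalSpace X] [TopologicalSpace Y] [T2Space X]
    [T2Space Y] {A B : Set X} {C D : Set Y} (hA : IsCompact A) (hB : IsCompact B)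
    (hAB : Disjoint A B) (hCD : Disjoint C D) (h : SetHomeo A C) (k : SetHomeo B D) :
    SetHomeo (A ∪ B) (C ∪ D) := by
  classical
  rcases isEmpty_or_nonempty Y with hY | hY
  · have hA' : A = ∅ := Set.eq_empty_of_forall_notMem fun x hx => hY.elim (h.some ⟨x, hx⟩ : C).1
    have hB' : B = ∅ := Set.eq_empty_of_forall_notMem fun x hx => hY.elim (k.some ⟨x, hx⟩ : D).1
    rw [hA', empty_union]
    rw [Set.eq_empty_of_isEmpty C, empty_union]
    exact k
  obtain ⟨f, hfc, hfi, hf⟩ := h.exists_fun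
  obtain ⟨g, hgc, hgi, hg⟩ := k.exists_fun
  have hBA : ∀ x ∈ B, x ∉ A := fun x hx => hAB.notMem_of_mem_right hx
  have hfm : ∀ x ∈ A, f x ∈ C := fun x hx => hf ▸ mem_image_of_mem f hx
  have hgm : ∀ x ∈ B, g x ∈ D := fun x hx => hg ▸ mem_image_of_mem g hx
  refine SetHomeo.of_image (f := fun x => if x ∈ A then f x else g x) (hA.union hB)
    (ContinuousOn.ite_mem_of_isClosed hA.isClosed hB.isClosed hAB hfc hgc) ?_ ?_
  · rintro x (hx | hx) y (hy | hy) hxy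
    · simp only [hx, hy, if_true] at hxy; exact hfi hx hy hxy
    · simp only [hx, hBA y hy, if_true, if_false] at hxy
      exact absurd (hxy ▸ hfm x hx) (hCD.notMem_of_mem_right (hgm y hy))
    · simp only [hy, hBA x hx, if_true, if_false] at hxy
      exact absurd (hxy ▸ hgm x hx) (hCD.notMem_of_mem_left (hfm y hy))
    · simp only [hBA x hx, hBA y hy, if_false] at hxy; exact hgi hx hy hxy
  · rw [image_union, ← hf, ← hg]
    congr 1
    · exact image_congr fun x hx => by simp [hx]
    · exact image_congr fun x hx => by simp [hBA x hx]

theorem SetHomeo.prod_singleton {X Y : Type*} [TopologicalSpace X] [TopologicalSpace Y] [T2Space X]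
    {A : Set X} (hA : IsCompact A) (b : Y) : SetHomeo (A ×ˢ {b}) A := by
  refine SetHomeo.of_image (hA.prod isCompact_singleton) continuous_fst.continuousOn ?_
    (fst_image_prod _ (singleton_nonempty _))
  rintro ⟨x, y⟩ ⟨-, h1⟩ ⟨x', y'⟩ ⟨-, h2⟩ h
  exact Prod.ext h (h1.trans h2.symm)

theorem SetHomeo.singleton_prod {X Y : Type*} [TopologicalSpace X] [TopologicalSpace Y] [T2Space X]
    {A : Set X} (hA : IsCompact A) (b : Y) : SetHomeo ({b} ×ˢ A) A := by
  refine SetHomeo.of_image (isCompact_singleton.prod hA) continuous_snd.continuousOn ?_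
    (snd_image_prod (singleton_nonempty _) _)
  rintro ⟨x, y⟩ ⟨h1, -⟩ ⟨x', y'⟩ ⟨h2, -⟩ h
  exact Prod.ext (h1.trans h2.symm) h

theorem setHomeo_Icc_omega_one {a : Ordinal.{0}} (ha : a < ω₁) :
    SetHomeo (Icc a ω₁) (Iic (ω₁ : Ordinal.{0})) := setHomeo_Icc (add_omega_one ha)

/-! ### Compact sublattices: plank, square and triangle -/

/-- A compact sublattice of the square, as a set of pairs of ordinals. -/
structure SqLat (S : Set (Ordinal.{0} × Ordinal.{0})) : Prop where
  compact : IsCompact S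
  sub : S ⊆ Iic ω₁ ×ˢ Iic ω₁
  sup : ∀ x y x' y', (x, y) ∈ S → (x', y') ∈ S → (max x x', max y y') ∈ S
  inf : ∀ x y x' y', (x, y) ∈ S → (x', y') ∈ S → (min x x', min y y') ∈ S

namespace SqLat

variable {S : Set (Ordinal.{0} × Ordinal.{0})}

theorem swap (hS : SqLat S) : SqLat (Prod.swap '' S) where
  compact := hS.compact.image continuous_swap
  sub := by
    rintro _ ⟨p, hp, rfl⟩
    exact ⟨(hS.sub hp).2, (hS.sub hp).1⟩
  sup := by
    rintro _ _ _ _ ⟨⟨x, y⟩, hp, h⟩ ⟨⟨x', y'⟩, hp', h'⟩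
    cases h; cases h'
    exact ⟨_, hS.sup _ _ _ _ hp hp', rfl⟩
  inf := by
    rintro _ _ _ _ ⟨⟨x, y⟩, hp, h⟩ ⟨⟨x', y'⟩, hp', h'⟩
    cases h; cases h'
    exact ⟨_, hS.inf _ _ _ _ hp hp', rfl⟩

theorem mem_swap {x y : Ordinal.{0}} : (x, y) ∈ Prod.swap '' S ↔ (y, x) ∈ S := by
  constructor
  · rintro ⟨⟨x', y'⟩, hp, h⟩; cases h; exact hp
  · intro h; exact ⟨_, h, rfl⟩

theorem setHomeo_swap (hS : IsCompact S) : SetHomeo S (Prod.swap '' S) :=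
  SetHomeo.image hS continuous_swap.continuousOn Prod.swap_injective.injOn

/-- If x ≤ x', the meet of (x', y) with the upper point is (x, y); if x' ≤ x, the join with the
lower point is. -/
theorem convex_snd (hS : SqLat S) {x x' y₁ y₂ y : Ordinal.{0}} (h1 : (x, y₁) ∈ S) (h2 : (x, y₂) ∈ S)
    (h : (x', y) ∈ S) (hy1 : y₁ ≤ y) (hy2 : y ≤ y₂) : (x, y) ∈ S := by
  rcases le_total x x' with hx | hx
  · have := hS.inf _ _ _ _ h h2
    rwa [min_eq_right hx, min_eq_left hy2] at this
  · have := hS.sup _ _ _ _ h h1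
    rwa [max_eq_right hx, max_eq_left hy1] at this

theorem convex_fst (hS : SqLat S) {y y' x₁ x₂ x : Ordinal.{0}} (h1 : (x₁, y) ∈ S) (h2 : (x₂, y) ∈ S)
    (h : (x, y') ∈ S) (hx1 : x₁ ≤ x) (hx2 : x ≤ x₂) : (x, y) ∈ S :=
  mem_swap.1 (hS.swap.convex_snd (mem_swap.2 h1) (mem_swap.2 h2) (mem_swap.2 h) hx1 hx2)

/-- Rows below the section over `ω₁` are uniformly bounded. -/
theorem exists_bound_row (hS : SqLat S) {C : Set Ordinal.{0}} (hC : C.Countable)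
    (h : ∀ y ∈ C, (ω₁, y) ∉ S) : ∃ δ < ω₁, ∀ y ∈ C, ∀ x, (x, y) ∈ S → x ≤ δ := by
  refine exists_bound_lt_omega_one hC (φ := fun y δ => ∀ x, (x, y) ∈ S → x ≤ δ) (fun y hy => ?_)
    (fun y β β' hβ h x hx => (h x hx).trans hβ)
  obtain ⟨β, h1, h2⟩ := exists_bound_fst (S := S ∩ Prod.snd ⁻¹' {y})
    (hS.compact.inter_right (isClosed_singleton.preimage continuous_snd))
    (inter_subset_left.trans hS.sub) (fun y' hy' => h y hy (by
      have : y' = y := hy'.2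
      exact this ▸ hy'.1))
  exact ⟨β, h1, fun x hx => (h2 (x, y) ⟨hx, rfl⟩).le⟩

theorem ordLike_inter_fst (hS : SqLat S) {δ c : Ordinal.{0}} (hδ : δ < ω₁) (hc : c < ω₁)
    (h : ∀ p ∈ S, p.1 ≤ δ → p.2 ≤ c) : OrdLike (S ∩ Prod.fst ⁻¹' Iic δ) := by
  refine OrdLike.of_subset_rectangle (max_lt hδ hc)
    (hS.compact.inter_right (isClosed_Iic.preimage continuous_fst)) ?_
  rintro ⟨x, y⟩ ⟨hp, hx⟩
  exact ⟨(show x ≤ δ from hx).trans (le_max_left _ _), (h _ hp hx).trans (le_max_right _ _)⟩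

/-- Beyond some countable column δ, the points off the right edge fill exactly the rows from y₀ to
y₁. So S consists of a countable part, a box [δ + 1, ω₁] × [y₀, y₁], and the rest N of the right
edge. The countable part is absorbed by the row y₀ of the box. -/
theorem plank (hS : SqLat S) {α : Ordinal.{0}} (hfst : ∀ x ≤ ω₁, ∃ y, (x, y) ∈ S)
    (hsnd : ∀ y, (∃ x, (x, y) ∈ S) ↔ y ≤ α) (hα : α ≤ ω₁)
    (hbd : ∃ c < ω₁, ∀ p ∈ S, p.1 < ω₁ → p.2 ≤ c) :
    ∃ β < (ω₁ : Ordinal.{0}), SetHomeo S (Iic (ω₁ : Ordinal.{0}) ×ˢ Iic β) := by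
  obtain ⟨c, hc, hbd⟩ := hbd
  set Y := {y | ∃ x < ω₁, (x, y) ∈ S} with hY
  have hYc : Y.Countable := (countable_Iic_of_lt hc).mono fun y ⟨x, hx, h⟩ => hbd (x, y) h hx
  obtain ⟨y₀, hy₀, hmin⟩ := WellFounded.has_min (wellFounded_lt (α := Ordinal.{0}))
    {y | (ω₁, y) ∈ S} (hfst ω₁ le_rfl)
  have hmin' : ∀ y, (ω₁, y) ∈ S → y₀ ≤ y := fun y hy => not_lt.1 (hmin y hy)
  have htop : (ω₁, α) ∈ S := by
    obtain ⟨x, hx⟩ := (hsnd α).2 le_rfl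
    have := hS.sup _ _ _ _ hy₀ hx
    rwa [max_eq_left (hS.sub hx).1, max_eq_right ((hsnd y₀).1 ⟨_, hy₀⟩)] at this
  have hsec : ∀ y, y₀ ≤ y → y ≤ α → (ω₁, y) ∈ S := by
    intro y h1 h2
    obtain ⟨x, hx⟩ := (hsnd y).2 h2
    exact hS.convex_snd hy₀ htop hx h1 h2
  obtain ⟨x₁, hx₁, hx₁'⟩ := exists_bound_lt_omega_one hYc (φ := fun y β => ∃ x ≤ β, (x, y) ∈ S)
    (fun y ⟨x, hx, h⟩ => ⟨x, hx, x, le_rfl, h⟩)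
    (fun y β β' h ⟨x, hx, hxy⟩ => ⟨x, hx.trans h, hxy⟩)
  obtain ⟨δ₁, hδ₁, hδ₁'⟩ := hS.exists_bound_row (C := Y ∩ Iio y₀) (hYc.mono inter_subset_left)
    (fun y hy h => not_le.2 hy.2 (hmin' y h))
  set δ := max x₁ δ₁ with hδd
  -- Every height attained off the right edge is attained by column x₁, and no row below y₀ that is
  -- attained off the edge extends past δ₁.
  have hδ : δ < ω₁ := max_lt hx₁ hδ₁
  have hδ1 := succ_lt_omega_one hδ
  have hge : ∀ x y, δ < x → (x, y) ∈ S → y₀ ≤ y := by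
    intro x y hx hp
    rcases (show x ≤ ω₁ from (hS.sub hp).1).lt_or_eq with h | h
    · by_contra! hlt
      exact absurd (hδ₁' y ⟨⟨x, h, hp⟩, hlt⟩ x hp) (not_le.2 ((le_max_right _ _).trans_lt hx))
    · subst h; exact hmin' y hp
  have hYcomp : IsCompact (Prod.snd '' (S ∩ Prod.fst ⁻¹' Iic x₁)) :=
    (hS.compact.inter_right (isClosed_Iic.preimage continuous_fst)).image continuous_snd
  obtain ⟨yδ, hyδ⟩ := hfst (δ + 1) hδ1.le
  have hYmem : ∀ y ∈ Y, y ∈ Prod.snd '' (S ∩ Prod.fst ⁻¹' Iic x₁) := fun y hy => by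
    obtain ⟨x, hx, h⟩ := hx₁' y hy
    exact ⟨(x, y), ⟨h, hx⟩, rfl⟩
  -- The columns up to x₁ form a compact set attaining all these heights, so a largest height
  -- exists.
  obtain ⟨y₁, ⟨⟨⟨x₂, _⟩, ⟨hp₂, hx₂⟩, rfl⟩, hy₁⟩⟩ :=
    hYcomp.exists_isGreatest ⟨yδ, hYmem yδ ⟨_, hδ1, hyδ⟩⟩
  rename_i y₁
  replace hx₂ : x₂ ≤ x₁ := hx₂
  have hx₂' : x₂ ≤ δ := hx₂.trans (le_max_left _ _)
  have hmax : ∀ y ∈ Y, y ≤ y₁ := fun y hy => hy₁ (hYmem y hy)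
  have hy₁c : y₁ ≤ c := hbd _ hp₂ (hx₂.trans_lt hx₁)
  have hy₁ω : y₁ < ω₁ := hy₁c.trans_lt hc
  have hy₁α : y₁ ≤ α := (hsnd _).1 ⟨_, hp₂⟩
  have hy01 : y₀ ≤ y₁ := (hge _ _ (Order.lt_add_one_iff.2 le_rfl) hyδ).trans
    (hmax _ ⟨_, hδ1, hyδ⟩)
  have hy₀ω : y₀ < ω₁ := hy01.trans_lt hy₁ω
  have hmem : ∀ x y, δ < x → x ≤ ω₁ → y₀ ≤ y → y ≤ y₁ → (x, y) ∈ S := by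
    intro x y h1 h2 h3 h4
    rcases h2.lt_or_eq with h5 | rfl
    · obtain ⟨z, hz⟩ := hfst x h2
      have hz1 := hmax z ⟨x, h5, hz⟩
      have h6 := hS.sup _ _ _ _ hz hp₂
      rw [max_eq_left (hx₂'.trans h1.le), max_eq_right hz1] at h6
      have h7 := hS.inf _ _ _ _ hz hy₀
      rw [min_eq_left h2, min_eq_right (hge _ _ h1 hz)] at h7
      obtain ⟨x', hx'⟩ := (hsnd y).2 (h4.trans hy₁α)
      exact hS.convex_snd h7 h6 hx' h3 h4
    · exact hsec y h3 (h4.trans hy₁α)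
  set L := S ∩ Prod.fst ⁻¹' Iic δ with hL
  set K := Icc (δ + 1) ω₁ ×ˢ {y₀} with hK
  set M := Icc (δ + 1) ω₁ ×ˢ Icc (y₀ + 1) y₁ with hM
  set N := {(ω₁ : Ordinal.{0})} ×ˢ Icc (y₁ + 1) α with hN
  have hLo : OrdLike L := hS.ordLike_inter_fst hδ hc fun p hp h => hbd p hp (h.trans_lt hδ)
  have hKh : SetHomeo K (Iic (ω₁ : Ordinal.{0})) :=
    (SetHomeo.prod_singleton isCompact_Icc _).trans (setHomeo_Icc_omega_one hδ1)
  have hMc : IsCompact M := isCompact_Icc.prod isCompact_Icc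
  have hNc : IsCompact N := isCompact_singleton.prod isCompact_Icc
  have hMK : Disjoint M K := by
    rw [Set.disjoint_left]
    rintro ⟨x, y⟩ ⟨-, h1, -⟩ ⟨-, h2⟩
    rw [show y = y₀ from h2] at h1
    exact absurd (Order.add_one_le_iff.1 h1) (lt_irrefl _)
  have hNK : Disjoint N K := by
    rw [Set.disjoint_left]
    rintro ⟨x, y⟩ ⟨-, h1, -⟩ ⟨-, h2⟩
    rw [show y = y₀ from h2] at h1
    exact absurd (Order.add_one_le_iff.1 h1) (not_lt.2 hy01)
  have hMN : Disjoint M N := by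
    rw [Set.disjoint_left]
    rintro ⟨x, y⟩ ⟨-, -, h1⟩ ⟨-, h2, -⟩
    exact absurd (Order.add_one_le_iff.1 h2) (not_lt.2 h1)
  have hML : Disjoint M L := by
    rw [Set.disjoint_left]
    rintro ⟨x, y⟩ ⟨⟨h1, -⟩, -⟩ ⟨-, h2⟩
    exact absurd (Order.add_one_le_iff.1 h1) (not_lt.2 h2)
  have hLK : Disjoint L K := by
    rw [Set.disjoint_left]
    rintro ⟨x, y⟩ ⟨-, h2⟩ ⟨⟨h1, -⟩, -⟩
    exact absurd (Order.add_one_le_iff.1 h1) (not_lt.2 h2)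
  have hLN : Disjoint L N := by
    rw [Set.disjoint_left]
    rintro ⟨x, y⟩ ⟨-, h2⟩ ⟨h1, -⟩
    rw [show x = ω₁ from h1] at h2
    exact absurd hδ (not_lt.2 h2)
  have hMKe : M ∪ K = Icc (δ + 1) ω₁ ×ˢ Icc y₀ y₁ := by
    rw [← prod_union]
    congr 1
    ext y
    simp only [mem_union, mem_Icc, mem_singleton_iff]
    constructor
    · rintro (⟨h1, h2⟩ | rfl)
      · exact ⟨(Order.add_one_le_iff.1 h1).le, h2⟩
      · exact ⟨le_rfl, hy01⟩
    · rintro ⟨h1, h2⟩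
      rcases h1.lt_or_eq with h | h
      · exact Or.inl ⟨Order.add_one_le_iff.2 h, h2⟩
      · exact Or.inr h.symm
  have hSeq : S = (M ∪ K) ∪ (L ∪ N) := by
    rw [hMKe]
    ext ⟨x, y⟩
    simp only [mem_union, mem_prod, mem_Icc, hL, hN, mem_inter_iff, mem_preimage, mem_Iic,
      mem_singleton_iff]
    constructor
    · intro hp
      rcases le_or_gt x δ with h | h
      · exact Or.inr (Or.inl ⟨hp, h⟩)
      · have hx : x ≤ ω₁ := (hS.sub hp).1
        rcases le_or_gt y y₁ with h' | h'
        · exact Or.inl ⟨⟨Order.add_one_le_iff.2 h, hx⟩, hge _ _ h hp, h'⟩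
        · refine Or.inr (Or.inr ⟨?_, Order.add_one_le_iff.2 h', (hsnd y).1 ⟨_, hp⟩⟩)
          by_contra hne
          exact not_lt.2 (hmax y ⟨x, lt_of_le_of_ne hx hne, hp⟩) h'
    · rintro (⟨⟨h1, h2⟩, h3, h4⟩ | ⟨h, -⟩ | ⟨rfl, h1, h2⟩)
      · exact hmem _ _ (Order.add_one_le_iff.1 h1) h2 h3 h4
      · exact h
      · exact hsec y (hy01.trans (Order.add_one_le_iff.1 h1).le) h2
  have hbox : SetHomeo (M ∪ K) (Iic (ω₁ : Ordinal.{0}) ×ˢ Iic (y₁ - y₀)) := by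
    rw [hMKe]
    exact (setHomeo_Icc_omega_one hδ1).prod (setHomeo_Icc (Ordinal.add_sub_cancel_of_le hy01))
  have hempty : OrdLike (∅ : Set (Ordinal.{0} × Ordinal.{0})) := Or.inl rfl
  have hβ : y₁ - y₀ < ω₁ := (Ordinal.sub_le_self _ _).trans_lt hy₁ω
  rcases hα.lt_or_eq with hα | rfl
  · refine ⟨y₁ - y₀, hβ, ?_⟩
    have hNo : OrdLike N := by
      rcases lt_or_ge α (y₁ + 1) with h | h
      · left; rw [hN, Icc_eq_empty (not_le.2 h), prod_empty]
      · exact Or.inr ⟨_, (Ordinal.sub_le_self _ _).trans_lt hα,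
          (SetHomeo.singleton_prod isCompact_Icc _).trans
            (setHomeo_Icc (Ordinal.add_sub_cancel_of_le h))⟩
    have := SetHomeo.absorb hMc hKh (hLo.union hNo hLN) hempty hMK (by simp [hML, hMN])
      (by simp) (by simp [hLK, hNK]) (by simp)
    rw [empty_union] at this
    have e : S = M ∪ (L ∪ N ∪ K) := by rw [hSeq, union_comm (L ∪ N) K, union_assoc]
    rw [e]
    exact this.trans hbox
  -- When α = ω₁ the remaining edge N is itself a clopen copy of ω₁ + 1. It becomes the extra row 0
  -- under the shifted box.
  · refine ⟨1 + (y₁ - y₀), add_lt_omega_one (by simpa using succ_lt_omega_one (omega_pos 1)) hβ, ?_⟩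
    have := SetHomeo.absorb (hMc.union hNc) hKh hLo hempty (by simp [hMK, hNK])
      (by simp [hML, hLN.symm]) (by simp) hLK (by simp)
    rw [empty_union] at this
    have e : S = M ∪ N ∪ (L ∪ K) := by
      rw [hSeq]; ext p; simp only [mem_union]; tauto
    rw [e]
    refine this.trans ?_
    have e2 : M ∪ N ∪ K = (M ∪ K) ∪ N := by ext p; simp only [mem_union]; tauto
    rw [e2]
    have e3 : Iic (ω₁ : Ordinal.{0}) ×ˢ Iic (1 + (y₁ - y₀)) =
        (Iic ω₁ ×ˢ Icc 1 (1 + (y₁ - y₀))) ∪ Iic ω₁ ×ˢ {0} := by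
      rw [← prod_union]
      congr 1
      ext y
      simp only [mem_Iic, mem_union, mem_Icc, mem_singleton_iff]
      constructor
      · intro h
        rcases eq_or_ne y 0 with h0 | h0
        · exact Or.inr h0
        · exact Or.inl ⟨Order.one_le_iff_pos.2 (pos_iff_ne_zero.2 h0), h⟩
      · rintro (h | rfl)
        · exact h.2
        · exact zero_le
    rw [e3]
    refine SetHomeo.union (hMc.union (hKh.symm.isCompact (isCompact_Iic_ordinal _))) hNc
      (by simp [hMN, hNK.symm]) ?_ (hbox.trans ?_) ?_
    · rw [Set.disjoint_left]
      rintro ⟨x, y⟩ ⟨-, h1, -⟩ ⟨-, h2⟩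
      rw [show y = 0 from h2] at h1
      exact absurd h1 (by simp)
    · exact (SetHomeo.refl _).prod (setHomeo_Icc rfl).symm
    · exact ((SetHomeo.singleton_prod isCompact_Icc _).trans
        (setHomeo_Icc_omega_one (succ_lt_omega_one hy₁ω))).trans
        (SetHomeo.prod_singleton (isCompact_Iic_ordinal _) _).symm

/-- Convexity and meets fill the box [b, ω₁] × [a, ω₁]. Outside it S has only points with both
coordinates at most γ, so S and the box differ in countable corners L and L', both absorbed by the
same row K. -/
theorem square (hS : SqLat S) (hfst : ∀ x ≤ ω₁, ∃ y, (x, y) ∈ S) (hsnd : ∀ y ≤ ω₁, ∃ x, (x, y) ∈ S)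
    {a b : Ordinal.{0}} (ha : a < ω₁) (hb : b < ω₁) (haS : (ω₁, a) ∈ S) (hbS : (b, ω₁) ∈ S)
    (hamin : ∀ y, (ω₁, y) ∈ S → a ≤ y) (hbmin : ∀ x, (x, ω₁) ∈ S → b ≤ x) :
    SetHomeo S (Iic (ω₁ : Ordinal.{0}) ×ˢ Iic (ω₁ : Ordinal.{0})) := by
  have hT : (ω₁, ω₁) ∈ S := by
    have := hS.sup _ _ _ _ haS hbS
    rwa [max_eq_left hb.le, max_eq_right ha.le] at this
  have hmem : ∀ x y, b ≤ x → x ≤ ω₁ → a ≤ y → y ≤ ω₁ → (x, y) ∈ S := by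
    intro x y h1 h2 h3 h4
    obtain ⟨y', hy'⟩ := hfst x h2
    obtain ⟨x', hx'⟩ := hsnd y h4
    have := hS.inf _ _ _ _ (hS.convex_fst hbS hT hy' h1 h2) (hS.convex_snd haS hT hx' h3 h4)
    rwa [min_eq_left h2, min_eq_right h4] at this
  obtain ⟨γ₁, hγ₁, hγ₁'⟩ := hS.exists_bound_row (countable_Iio_iff_lt_omega_one.2 ha)
    (fun y hy h => not_le.2 hy (hamin y h))
  obtain ⟨γ₂, hγ₂, hγ₂'⟩ := hS.swap.exists_bound_row (countable_Iio_iff_lt_omega_one.2 hb)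
    (fun y hy h => not_le.2 hy (hbmin y (mem_swap.1 h)))
  obtain ⟨γ, hγ, h1, h2, h3, h4⟩ : ∃ γ < ω₁, γ₁ ≤ γ ∧ γ₂ ≤ γ ∧ a ≤ γ ∧ b ≤ γ :=
    ⟨max (max γ₁ γ₂) (max a b), max_lt (max_lt hγ₁ hγ₂) (max_lt ha hb), by simp, by simp, by simp,
      by simp⟩
  have hγ1 := succ_lt_omega_one hγ
  set L := S ∩ Iic γ ×ˢ Iic γ with hL
  set L' := Icc b γ ×ˢ Icc a γ with hL'
  set K := Icc (γ + 1) ω₁ ×ˢ {a} with hK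
  set M := Icc b γ ×ˢ Icc (γ + 1) ω₁ ∪ Icc (γ + 1) ω₁ ×ˢ Icc (a + 1) ω₁ with hM
  have hS1 : S = M ∪ (L ∪ K) := by
    ext ⟨x, y⟩
    simp only [mem_union, mem_prod, mem_Icc, hL, hM, hK, mem_inter_iff, mem_Iic,
      mem_singleton_iff]
    constructor
    · intro hp
      have hp' : x ≤ ω₁ ∧ y ≤ ω₁ := hS.sub hp
      rcases le_or_gt x γ with h5 | h5
      · rcases le_or_gt y γ with h6 | h6
        · exact Or.inr (Or.inl ⟨hp, h5, h6⟩)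
        · refine Or.inl (Or.inl ⟨⟨?_, h5⟩, Order.add_one_le_iff.2 h6, hp'.2⟩)
          by_contra! h
          exact absurd ((hγ₂' x h y (mem_swap.2 hp)).trans h2) (not_le.2 h6)
      · have hay : a ≤ y := by
          by_contra! h
          exact absurd ((hγ₁' y h x hp).trans h1) (not_le.2 h5)
        have h5' := Order.add_one_le_iff.2 h5
        rcases hay.lt_or_eq with h6 | h6
        · exact Or.inl (Or.inr ⟨⟨h5', hp'.1⟩, Order.add_one_le_iff.2 h6, hp'.2⟩)
        · exact Or.inr (Or.inr ⟨⟨h5', hp'.1⟩, h6.symm⟩)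
    · rintro ((⟨⟨h5, h6⟩, h7, h8⟩ | ⟨⟨h5, h6⟩, h7, h8⟩) | ⟨h, -⟩ | ⟨⟨h5, h6⟩, rfl⟩)
      · exact hmem _ _ h5 (h6.trans hγ.le) (h3.trans (Order.add_one_le_iff.1 h7).le) h8
      · exact hmem _ _ (h4.trans (Order.add_one_le_iff.1 h5).le) h6 (Order.add_one_le_iff.1 h7).le h8
      · exact h
      · exact hmem _ _ (h4.trans (Order.add_one_le_iff.1 h5).le) h6 le_rfl ha.le
  have hS2 : Icc b ω₁ ×ˢ Icc a ω₁ = M ∪ (L' ∪ K) := by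
    ext ⟨x, y⟩
    simp only [mem_union, mem_prod, mem_Icc, hL', hM, hK, mem_singleton_iff]
    constructor
    · rintro ⟨⟨h5, h6⟩, h7, h8⟩
      rcases le_or_gt x γ with h9 | h9
      · rcases le_or_gt y γ with h10 | h10
        · exact Or.inr (Or.inl ⟨⟨h5, h9⟩, h7, h10⟩)
        · exact Or.inl (Or.inl ⟨⟨h5, h9⟩, Order.add_one_le_iff.2 h10, h8⟩)
      · have h5' := Order.add_one_le_iff.2 h9
        rcases h7.lt_or_eq with h10 | h10
        · exact Or.inl (Or.inr ⟨⟨h5', h6⟩, Order.add_one_le_iff.2 h10, h8⟩)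
        · exact Or.inr (Or.inr ⟨⟨h5', h6⟩, h10.symm⟩)
    · rintro ((⟨⟨h5, h6⟩, h7, h8⟩ | ⟨⟨h5, h6⟩, h7, h8⟩) | ⟨⟨h5, h6⟩, h7, h8⟩ | ⟨⟨h5, h6⟩, rfl⟩)
      · exact ⟨⟨h5, h6.trans hγ.le⟩, h3.trans (Order.add_one_le_iff.1 h7).le, h8⟩
      · exact ⟨⟨h4.trans (Order.add_one_le_iff.1 h5).le, h6⟩, (Order.add_one_le_iff.1 h7).le, h8⟩
      · exact ⟨⟨h5, h6.trans hγ.le⟩, h7, h8.trans hγ.le⟩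
      · exact ⟨⟨h4.trans (Order.add_one_le_iff.1 h5).le, h6⟩, le_rfl, ha.le⟩
  have hdis : ∀ L₀ ⊆ Iic γ ×ˢ Iic γ, Disjoint M L₀ ∧ Disjoint L₀ K := by
    intro L₀ hL₀
    constructor
    · rw [Set.disjoint_left]
      rintro ⟨x, y⟩ (⟨-, h5, -⟩ | ⟨⟨h5, -⟩, -⟩) h6
      · exact absurd (hL₀ h6).2 (not_le.2 (Order.add_one_le_iff.1 h5))
      · exact absurd (hL₀ h6).1 (not_le.2 (Order.add_one_le_iff.1 h5))
    · rw [Set.disjoint_left]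
      rintro ⟨x, y⟩ h6 ⟨⟨h5, -⟩, -⟩
      exact absurd (hL₀ h6).1 (not_le.2 (Order.add_one_le_iff.1 h5))
  have hLs : L ⊆ Iic γ ×ˢ Iic γ := inter_subset_right
  have hLs' : L' ⊆ Iic γ ×ˢ Iic γ := prod_mono Icc_subset_Iic_self Icc_subset_Iic_self
  have hMK : Disjoint M K := by
    rw [Set.disjoint_left]
    rintro ⟨x, y⟩ (⟨⟨-, h5⟩, -⟩ | ⟨-, h5, -⟩) ⟨⟨h6, -⟩, h7⟩
    · exact absurd h5 (not_le.2 (Order.add_one_le_iff.1 h6))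
    · rw [show y = a from h7] at h5
      exact absurd (Order.add_one_le_iff.1 h5) (lt_irrefl _)
  have := SetHomeo.absorb (M := M) (K := K) (L := L) (L' := L')
    ((isCompact_Icc.prod isCompact_Icc).union (isCompact_Icc.prod isCompact_Icc))
    ((SetHomeo.prod_singleton isCompact_Icc _).trans (setHomeo_Icc_omega_one hγ1))
    (OrdLike.of_subset_rectangle hγ (hS.compact.inter_right (isClosed_Iic.prod isClosed_Iic)) hLs)
    (OrdLike.of_subset_rectangle hγ (isCompact_Icc.prod isCompact_Icc) hLs')
    hMK (hdis L hLs).1 (hdis L' hLs').1 (hdis L hLs).2 (hdis L' hLs').2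
  rw [← hS1, ← hS2] at this
  exact this.trans ((setHomeo_Icc_omega_one hb).prod (setHomeo_Icc_omega_one ha))

/-- The region on and below the diagonal of the square. -/
abbrev lowerTriangle : Set (Ordinal.{0} × Ordinal.{0}) := {p | p.2 ≤ p.1 ∧ p.1 ≤ ω₁}

theorem stair_lowerTriangle : Stair lowerTriangle where
  compact := by
    have h : lowerTriangle = (Iic ω₁ ×ˢ Iic ω₁) ∩ {p | p.2 ≤ p.1} := by
      ext ⟨x, y⟩
      simp only [mem_ofPred_eq, mem_inter_iff, mem_prod, mem_Iic]
      exact ⟨fun h => ⟨⟨h.2, h.1.trans h.2⟩, h.1⟩, fun h => ⟨h.2, h.1.1⟩⟩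
    rw [h]
    exact ((isCompact_Iic_ordinal _).prod (isCompact_Iic_ordinal _)).inter_right
      (isClosed_le continuous_snd continuous_fst)
  sub := fun p hp => ⟨hp.2, hp.1.trans hp.2⟩
  up := fun u v u' v' h h1 h2 h3 => ⟨(h3.trans h.1).trans h1, h2⟩
  bot := fun u hu => ⟨zero_le, hu⟩
  top := fun u h => le_antisymm h.2 h.1
  cof := fun y hy => ⟨y, hy, le_rfl, hy.le⟩

/-- Past column δ the set is closed under moving right and under moving down to height a, and its
heights are cofinal. After absorbing the earlier columns and translating to the origin it is a
staircase. -/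
theorem triangular (hS : SqLat S) (hfst : ∀ x ≤ ω₁, ∃ y, (x, y) ∈ S)
    (hsnd : ∀ y ≤ ω₁, ∃ x, (x, y) ∈ S) {a : Ordinal.{0}} (ha : a < ω₁) (haS : (ω₁, a) ∈ S)
    (hamin : ∀ y, (ω₁, y) ∈ S → a ≤ y) (htop : ∀ x, (x, ω₁) ∈ S → x = ω₁)
    (hunb : ∀ c < ω₁, ∃ p ∈ S, p.1 < ω₁ ∧ c < p.2) : SetHomeo S lowerTriangle := by
  obtain ⟨δ, hδ, hδ'⟩ := hS.exists_bound_row (countable_Iio_iff_lt_omega_one.2 ha)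
    (fun y hy h => not_le.2 hy (hamin y h))
  have hδ1 := succ_lt_omega_one hδ
  have hge : ∀ x y, δ < x → (x, y) ∈ S → a ≤ y := fun x y hx hp => by
    by_contra! h
    exact not_le.2 hx (hδ' y h x hp)
  have hmem : ∀ x, δ < x → x ≤ ω₁ → (x, a) ∈ S := by
    intro x h1 h2
    obtain ⟨y, hy⟩ := hfst x h2
    have := hS.inf _ _ _ _ hy haS
    rwa [min_eq_left h2, min_eq_right (hge x y h1 hy)] at this
  have hup : ∀ x y x' y', δ < x → (x, y) ∈ S → x ≤ x' → x' ≤ ω₁ → a ≤ y' → y' ≤ y →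
      (x', y') ∈ S := by
    intro x y x' y' h1 hp h2 h3 h4 h5
    have h6 := hmem x' (h1.trans_le h2) h3
    have h7 := hS.sup _ _ _ _ hp h6
    rw [max_eq_right h2, max_eq_left (h4.trans h5)] at h7
    obtain ⟨z, hz⟩ := hsnd y' (h5.trans (hS.sub hp).2)
    exact hS.convex_snd h6 h7 hz h4 h5
  obtain ⟨c, hc, hc'⟩ := exists_bound_snd (S := S ∩ Prod.fst ⁻¹' Iic δ)
    (hS.compact.inter_right (isClosed_Iic.preimage continuous_fst))
    (inter_subset_left.trans hS.sub) (fun x hx => absurd (htop x hx.1 ▸ hx.2) (not_le.2 hδ))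
  set L := S ∩ Prod.fst ⁻¹' Iic δ with hL
  set K := Icc (δ + 1) ω₁ ×ˢ {a} with hK
  set M := S ∩ Ici (δ + 1) ×ˢ Ici (a + 1) with hM
  have hLo : OrdLike L := hS.ordLike_inter_fst hδ hc fun p hp h => (hc' p ⟨hp, h⟩).le
  have hW : M ∪ K = S ∩ Prod.fst ⁻¹' Ici (δ + 1) := by
    ext ⟨x, y⟩
    simp only [mem_union, mem_prod, mem_Icc, hM, hK, mem_inter_iff, mem_Ici, mem_preimage,
      mem_singleton_iff]
    constructor
    · rintro (⟨h1, h2, -⟩ | ⟨⟨h1, h2⟩, rfl⟩)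
      · exact ⟨h1, h2⟩
      · exact ⟨hmem _ (Order.add_one_le_iff.1 h1) h2, h1⟩
    · rintro ⟨h1, h2⟩
      rcases (hge x y (Order.add_one_le_iff.1 h2) h1).lt_or_eq with h3 | h3
      · exact Or.inl ⟨h1, h2, Order.add_one_le_iff.2 h3⟩
      · exact Or.inr ⟨⟨h2, (hS.sub h1).1⟩, h3.symm⟩
  have hSe : S = M ∪ (L ∪ K) := by
    have : M ∪ (L ∪ K) = (M ∪ K) ∪ L := by ext p; simp only [mem_union]; tauto
    rw [this, hW, hL, ← inter_union_distrib_left]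
    refine (inter_eq_left.2 fun p _ => ?_).symm
    rcases le_or_gt p.1 δ with h | h
    · exact Or.inr h
    · exact Or.inl (Order.add_one_le_iff.2 h)
  have habs := SetHomeo.absorb (M := M) (K := K) (L := L) (L' := ∅)
    (hS.compact.inter_right (isClosed_Ici.prod isClosed_Ici))
    ((SetHomeo.prod_singleton isCompact_Icc _).trans (setHomeo_Icc_omega_one hδ1)) hLo (Or.inl rfl)
    (by
      rw [Set.disjoint_left]
      rintro ⟨x, y⟩ ⟨-, -, h1⟩ ⟨-, h2⟩
      rw [show y = a from h2] at h1
      exact absurd (Order.add_one_le_iff.1 (show a + 1 ≤ a from h1)) (lt_irrefl _))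
    (by
      rw [Set.disjoint_left]
      rintro ⟨x, y⟩ ⟨-, h1, -⟩ ⟨-, h2⟩
      exact absurd (Order.add_one_le_iff.1 (show δ + 1 ≤ x from h1)) (not_lt.2 h2))
    (by simp)
    (by
      rw [Set.disjoint_left]
      rintro ⟨x, y⟩ ⟨-, h2⟩ ⟨⟨h1, -⟩, -⟩
      exact absurd (Order.add_one_le_iff.1 h1) (not_lt.2 h2))
    (by simp)
  rw [← hSe, empty_union, hW] at habs
  refine habs.trans ?_
  set W := S ∩ Prod.fst ⁻¹' Ici (δ + 1) with hWd
  have hWc : IsCompact W := hS.compact.inter_right (isClosed_Ici.preimage continuous_fst)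
  -- Translation by (δ + 1, a), which preserves ω₁ in each coordinate.
  let Φ : Ordinal.{0} × Ordinal.{0} → Ordinal.{0} × Ordinal.{0} :=
    Prod.map (fun u => δ + 1 + u) (fun v => a + v)
  have hΦc : Continuous Φ := (Ordinal.isNormal_add_right _).continuous.prodMap
    (Ordinal.isNormal_add_right _).continuous
  have hΦi : Function.Injective Φ := by
    rintro ⟨u, v⟩ ⟨u', v'⟩ h
    have h1 : δ + 1 + u = δ + 1 + u' := congrArg Prod.fst h
    have h2 : a + v = a + v' := congrArg Prod.snd h
    exact Prod.ext (add_left_cancel h1) (add_left_cancel h2)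
  have hsub : Φ ⁻¹' W ⊆ Iic ω₁ ×ˢ Iic ω₁ := by
    rintro ⟨u, v⟩ ⟨h, -⟩
    have h1 : δ + 1 + u ≤ ω₁ := (hS.sub h).1
    have h2 : a + v ≤ ω₁ := (hS.sub h).2
    exact ⟨le_add_self.trans h1, le_add_self.trans h2⟩
  have hcomp : IsCompact (Φ ⁻¹' W) :=
    ((isCompact_Iic_ordinal _).prod (isCompact_Iic_ordinal _)).of_isClosed_subset
      (hWc.isClosed.preimage hΦc) hsub
  have hlt : ∀ u : Ordinal.{0}, δ < δ + 1 + u := fun u =>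
    (Order.lt_add_one_iff.2 le_rfl).trans_le le_self_add
  have hself : ∀ p, Φ p ∈ Prod.fst ⁻¹' Ici (δ + 1) := fun p =>
    show δ + 1 ≤ δ + 1 + p.1 from le_self_add
  have hle : ∀ u ≤ ω₁, δ + 1 + u ≤ ω₁ := fun u hu =>
    (add_le_add_right hu _).trans_eq (add_omega_one hδ1)
  have hstair : Stair (Φ ⁻¹' W) := by
    refine ⟨hcomp, hsub, ?_, ?_, ?_, ?_⟩
    · rintro u v u' v' ⟨h, -⟩ h1 h2 h3
      exact ⟨hup _ _ _ _ (hlt u) h (add_le_add_right h1 _) (hle _ h2) le_self_add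
        (add_le_add_right h3 _), hself _⟩
    · intro u hu
      have := hmem _ (hlt u) (hle u hu)
      refine ⟨?_, hself _⟩
      simpa [Φ] using this
    · rintro u ⟨h, -⟩
      have h' : (δ + 1 + u, a + ω₁) ∈ S := h
      rw [add_omega_one ha] at h'
      have h1 := htop _ h'
      refine le_antisymm (le_add_self.trans_eq h1) (not_lt.1 fun h2 => ?_)
      exact absurd h1 (add_lt_omega_one hδ1 h2).ne
    · intro y hy
      obtain ⟨⟨x, z⟩, hp, hp1, hp2⟩ := hunb (a + y) (add_lt_omega_one ha hy)
      have h1 := hS.sup _ _ _ _ hp (hmem (δ + 1) (Order.lt_add_one_iff.2 le_rfl) hδ1.le)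
      have h2 : δ + 1 ≤ max x (δ + 1) := le_max_right _ _
      have h3 : max x (δ + 1) < ω₁ := max_lt hp1 hδ1
      refine ⟨max x (δ + 1) - (δ + 1), (Ordinal.sub_le_self _ _).trans_lt h3, ?_⟩
      have h4 := hup _ _ _ (a + y) (Order.add_one_le_iff.1 h2) h1 le_rfl h3.le le_self_add
        (hp2.le.trans (le_max_left _ _))
      rw [← Ordinal.add_sub_cancel_of_le h2] at h4
      exact ⟨h4, hself _⟩
  refine SetHomeo.trans (SetHomeo.symm ?_) (hstair.setHomeo stair_lowerTriangle)
  refine SetHomeo.of_image hcomp hΦc.continuousOn hΦi.injOn (image_preimage_eq_of_subset ?_)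
  rintro ⟨x, y⟩ ⟨h1, h2⟩
  refine ⟨(x - (δ + 1), y - a), ?_⟩
  exact Prod.ext (Ordinal.add_sub_cancel_of_le h2)
    (Ordinal.add_sub_cancel_of_le (hge x y (Order.add_one_le_iff.1 h2) h1))

/-! ### The trichotomy -/

/-- The trichotomy, for sets of pairs of ordinals. -/
def Classified (S : Set (Ordinal.{0} × Ordinal.{0})) : Prop :=
  SetHomeo S lowerTriangle ∨ SetHomeo S (Iic (ω₁ : Ordinal.{0}) ×ˢ Iic (ω₁ : Ordinal.{0})) ∨
    ∃ β < (ω₁ : Ordinal.{0}), SetHomeo S (Iic (ω₁ : Ordinal.{0}) ×ˢ Iic β)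

theorem Classified.of_setHomeo {S T : Set (Ordinal.{0} × Ordinal.{0})} (h : SetHomeo S T)
    (hT : Classified T) : Classified S :=
  hT.imp h.trans (Or.imp h.trans fun ⟨β, hβ, k⟩ => ⟨β, hβ, h.trans k⟩)

theorem classified_of_section (hS : SqLat S) (hfst : ∀ x, (∃ y, (x, y) ∈ S) ↔ x ≤ ω₁)
    (hsnd : ∀ y, (∃ x, (x, y) ∈ S) ↔ y ≤ ω₁) {a : Ordinal.{0}} (ha : a < ω₁) (haS : (ω₁, a) ∈ S)
    (hamin : ∀ y, (ω₁, y) ∈ S → a ≤ y) : Classified S := by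
  obtain ⟨b, hbS, hbmin⟩ := WellFounded.has_min (wellFounded_lt (α := Ordinal.{0}))
    {x | (x, ω₁) ∈ S} ((hsnd ω₁).2 le_rfl)
  replace hbmin : ∀ x, (x, ω₁) ∈ S → b ≤ x := fun x hx => not_lt.1 (hbmin x hx)
  rcases (show b ≤ ω₁ from (hS.sub hbS).1).lt_or_eq with hb | rfl
  · exact Or.inr (Or.inl (hS.square (fun x => (hfst x).2) (fun y => (hsnd y).2) ha hb haS hbS
      hamin hbmin))
  · by_cases hbd : ∃ c < ω₁, ∀ p ∈ S, p.1 < ω₁ → p.2 ≤ c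
    · exact Or.inr (Or.inr (hS.plank (fun x => (hfst x).2) hsnd le_rfl hbd))
    · push Not at hbd
      exact Or.inl (hS.triangular (fun x => (hfst x).2) (fun y => (hsnd y).2) ha haS hamin
        (fun x hx => le_antisymm (hS.sub hx).1 (hbmin x hx)) hbd)

theorem classified_of_full (hS : SqLat S) (hunc : ¬ S.Countable) {α₁ α₂ : Ordinal.{0}}
    (h1 : α₁ ≤ ω₁) (h2 : α₂ ≤ ω₁) (hfst : ∀ x, (∃ y, (x, y) ∈ S) ↔ x ≤ α₁)
    (hsnd : ∀ y, (∃ x, (x, y) ∈ S) ↔ y ≤ α₂) : Classified S := by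
  have hfst' : ∀ x, (∃ y, (x, y) ∈ Prod.swap '' S) ↔ x ≤ α₂ := fun x => by
    rw [← hsnd]; simp only [mem_swap]
  have hsnd' : ∀ y, (∃ x, (x, y) ∈ Prod.swap '' S) ↔ y ≤ α₁ := fun x => by
    rw [← hfst]; simp only [mem_swap]
  rcases h2.lt_or_eq with h2' | rfl
  · have h1' : α₁ = ω₁ := by
      refine le_antisymm h1 (not_lt.1 fun h => hunc ?_)
      have hsub : S ⊆ Iic α₁ ×ˢ Iic α₂ := fun p hp =>
        ⟨(hfst p.1).1 ⟨_, hp⟩, (hsnd p.2).1 ⟨_, hp⟩⟩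
      exact ((countable_Iic_of_lt h).prod (countable_Iic_of_lt h2')).mono hsub
    subst h1'
    exact Or.inr (Or.inr (hS.plank (fun x => (hfst x).2) hsnd h2
      ⟨α₂, h2', fun p hp _ => (hsnd p.2).1 ⟨_, hp⟩⟩))
  rcases h1.lt_or_eq with h1' | rfl
  · refine Classified.of_setHomeo (setHomeo_swap hS.compact) (Or.inr (Or.inr ?_))
    exact hS.swap.plank (fun x => (hfst' x).2) hsnd' h1
      ⟨α₁, h1', fun p hp _ => (hsnd' p.2).1 ⟨_, hp⟩⟩
  obtain ⟨a, haS, hamin⟩ := WellFounded.has_min (wellFounded_lt (α := Ordinal.{0}))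
    {y | (ω₁, y) ∈ S} ((hfst ω₁).2 le_rfl)
  replace hamin : ∀ y, (ω₁, y) ∈ S → a ≤ y := fun x hx => not_lt.1 (hamin x hx)
  obtain ⟨b, hbS, hbmin⟩ := WellFounded.has_min (wellFounded_lt (α := Ordinal.{0}))
    {x | (x, ω₁) ∈ S} ((hsnd ω₁).2 le_rfl)
  replace hbmin : ∀ x, (x, ω₁) ∈ S → b ≤ x := fun x hx => not_lt.1 (hbmin x hx)
  rcases (show a ≤ ω₁ from (hS.sub haS).2).lt_or_eq with ha | rfl
  · exact hS.classified_of_section hfst hsnd ha haS hamin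
  rcases (show b ≤ ω₁ from (hS.sub hbS).1).lt_or_eq with hb | rfl
  · exact Classified.of_setHomeo (setHomeo_swap hS.compact) (hS.swap.classified_of_section hfst'
      hsnd' hb (mem_swap.2 hbS) fun y hy => hbmin y (mem_swap.1 hy))
  refine Or.inr (Or.inr ⟨0, omega_pos 1, ?_⟩)
  have h := setHomeo_Iic_of_pinched hS.compact hS.sub hunc
    (fun x hx => le_antisymm (hS.sub hx).1 (hbmin x hx))
    (fun x hx => le_antisymm (hS.sub hx).2 (hamin x hx))
  have e : Iic (0 : Ordinal.{0}) = {0} := by ext; simp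
  rw [e]
  exact h.trans (SetHomeo.prod_singleton (isCompact_Iic_ordinal _) _).symm

theorem classified (hS : SqLat S) (hunc : ¬ S.Countable) : Classified S := by
  have hne : S.Nonempty := nonempty_iff_ne_empty.2 fun h => hunc (h ▸ countable_empty)
  obtain ⟨e₁, α₁, h1, h1c, h1i, h1b⟩ := exists_collapse (hS.compact.image continuous_fst)
    (hne.image _)
  obtain ⟨e₂, α₂, h2, h2c, h2i, h2b⟩ := exists_collapse (hS.compact.image continuous_snd)
    (hne.image _)
  have hm1 : ∀ {x y}, (x, y) ∈ S → x ∈ Prod.fst '' S := fun h => ⟨_, h, rfl⟩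
  have hm2 : ∀ {x y}, (x, y) ∈ S → y ∈ Prod.snd '' S := fun h => ⟨_, h, rfl⟩
  have hα₁ : α₁ ≤ ω₁ := h1b _ (by rintro _ ⟨p, hp, rfl⟩; exact (hS.sub hp).1)
  have hα₂ : α₂ ≤ ω₁ := h2b _ (by rintro _ ⟨p, hp, rfl⟩; exact (hS.sub hp).2)
  have hle1 : ∀ {x y}, (x, y) ∈ S → e₁ x ≤ α₁ := fun h => by
    have := mem_image_of_mem e₁ (hm1 h); rwa [h1i] at this
  have hle2 : ∀ {x y}, (x, y) ∈ S → e₂ y ≤ α₂ := fun h => by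
    have := mem_image_of_mem e₂ (hm2 h); rwa [h2i] at this
  have hmax : ∀ {e : Ordinal.{0} → Ordinal.{0}} {C : Set Ordinal.{0}}, StrictMonoOn e C →
      ∀ {x y}, x ∈ C → y ∈ C → max (e x) (e y) = e (max x y) := by
    intro e C he x y hx hy
    rcases le_total x y with h | h
    · rw [max_eq_right h, max_eq_right (he.monotoneOn hx hy h)]
    · rw [max_eq_left h, max_eq_left (he.monotoneOn hy hx h)]
  have hmin : ∀ {e : Ordinal.{0} → Ordinal.{0}} {C : Set Ordinal.{0}}, StrictMonoOn e C →
      ∀ {x y}, x ∈ C → y ∈ C → min (e x) (e y) = e (min x y) := by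
    intro e C he x y hx hy
    rcases le_total x y with h | h
    · rw [min_eq_left h, min_eq_left (he.monotoneOn hx hy h)]
    · rw [min_eq_right h, min_eq_right (he.monotoneOn hy hx h)]
  -- The collapses are strictly increasing on the projections, so they preserve meets and joins:
  -- both projections may be taken to be initial segments.
  have hhomeo : SetHomeo S (Prod.map e₁ e₂ '' S) := by
    refine SetHomeo.image hS.compact ?_ ?_
    · exact (h1c.comp continuous_fst.continuousOn (mapsTo_image _ _)).prodMk
        (h2c.comp continuous_snd.continuousOn (mapsTo_image _ _))
    · rintro ⟨x, y⟩ hp ⟨x', y'⟩ hp' h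
      exact Prod.ext (h1.injOn (hm1 hp) (hm1 hp') (congrArg Prod.fst h))
        (h2.injOn (hm2 hp) (hm2 hp') (congrArg Prod.snd h))
  have hLat : SqLat (Prod.map e₁ e₂ '' S) := by
    refine ⟨hhomeo.isCompact hS.compact, ?_, ?_, ?_⟩
    · rintro _ ⟨⟨x, y⟩, hp, rfl⟩
      exact ⟨(hle1 hp).trans hα₁, (hle2 hp).trans hα₂⟩
    · rintro _ _ _ _ ⟨⟨x, y⟩, hp, h⟩ ⟨⟨x', y'⟩, hp', h'⟩
      cases h; cases h'
      refine ⟨_, hS.sup _ _ _ _ hp hp', ?_⟩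
      exact Prod.ext (hmax h1 (hm1 hp) (hm1 hp')).symm (hmax h2 (hm2 hp) (hm2 hp')).symm
    · rintro _ _ _ _ ⟨⟨x, y⟩, hp, h⟩ ⟨⟨x', y'⟩, hp', h'⟩
      cases h; cases h'
      refine ⟨_, hS.inf _ _ _ _ hp hp', ?_⟩
      exact Prod.ext (hmin h1 (hm1 hp) (hm1 hp')).symm (hmin h2 (hm2 hp) (hm2 hp')).symm
  refine Classified.of_setHomeo hhomeo (hLat.classified_of_full
    (fun h => hunc (hhomeo.symm.countable h)) hα₁ hα₂ (fun x => ?_) (fun y => ?_))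
  · constructor
    · rintro ⟨y, ⟨x', y'⟩, hp, h⟩
      cases h; exact hle1 hp
    · intro hx
      have : x ∈ e₁ '' (Prod.fst '' S) := h1i ▸ hx
      obtain ⟨_, ⟨⟨x', y'⟩, hp, rfl⟩, rfl⟩ := this
      exact ⟨e₂ y', ⟨_, hp, rfl⟩⟩
  · constructor
    · rintro ⟨y, ⟨x', y'⟩, hp, h⟩
      cases h; exact hle2 hp
    · intro hx
      have : y ∈ e₂ '' (Prod.snd '' S) := h2i ▸ hx
      obtain ⟨_, ⟨⟨x', y'⟩, hp, rfl⟩, rfl⟩ := this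
      exact ⟨e₁ x', ⟨_, hp, rfl⟩⟩

end SqLat

/-! ### Condensation points and exclusivity -/

/-- The points without countable neighbourhoods. -/
def condPts (X : Type*) [TopologicalSpace X] : Set X := {p | ∀ U ∈ 𝓝 p, ¬ U.Countable}

theorem Homeomorph.image_condPts {X Y : Type*} [TopologicalSpace X] [TopologicalSpace Y]
    (h : X ≃ₜ Y) : h '' condPts X = condPts Y := by
  ext y; constructor
  · rintro ⟨p, hp, rfl⟩ U hU hc
    exact hp _ (h.continuous.continuousAt hU) (hc.preimage_of_injOn h.injective.injOn)
  · intro hy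
    refine ⟨h.symm y, fun U hU hc => ?_, h.apply_symm_apply y⟩
    exact hy _ (h.symm.continuous.continuousAt hU) (hc.preimage_of_injOn h.symm.injective.injOn)

theorem mem_condPts_subtype {X : Type*} [TopologicalSpace X] {S : Set X} {p : S} :
    p ∈ condPts S ↔ ∀ U ∈ 𝓝 (p : X), ¬ (S ∩ U).Countable := by
  constructor
  · intro h U hU hc
    refine h (Subtype.val ⁻¹' U) (continuous_subtype_val.continuousAt hU) ?_
    refine MapsTo.countable_of_injOn (f := Subtype.val) (t := S ∩ U) ?_
      Subtype.val_injective.injOn hc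
    exact fun q hq => ⟨q.2, hq⟩
  · intro h U hU hc
    rw [nhds_subtype, mem_comap] at hU
    obtain ⟨V, hV, hVU⟩ := hU
    refine h V hV ((hc.image Subtype.val).mono ?_)
    rintro x ⟨hx, hxV⟩
    exact ⟨⟨x, hx⟩, hVU hxV, rfl⟩

/-- There are two uncountable closed sets of condensation points with at most one common point. -/
def HasTwoEnds (X : Type*) [TopologicalSpace X] : Prop :=
  ∃ A B : Set X, IsClosed A ∧ IsClosed B ∧ A ⊆ condPts X ∧ B ⊆ condPts X ∧ ¬ A.Countable ∧
    ¬ B.Countable ∧ (A ∩ B).Subsingleton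

theorem HasTwoEnds.of_homeomorph {X Y : Type*} [TopologicalSpace X] [TopologicalSpace Y]
    (h : X ≃ₜ Y) (hX : HasTwoEnds X) : HasTwoEnds Y := by
  obtain ⟨A, B, hA, hB, hA', hB', hAc, hBc, hAB⟩ := hX
  have hc : ∀ A : Set X, ¬ A.Countable → ¬ (h '' A).Countable := fun A hA hc =>
    hA (countable_of_injective_of_countable_image h.injective.injOn hc)
  refine ⟨h '' A, h '' B, h.isClosedMap A hA, h.isClosedMap B hB, ?_, ?_, hc A hAc, hc B hBc, ?_⟩
  · rw [← h.image_condPts]; exact image_mono hA'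
  · rw [← h.image_condPts]; exact image_mono hB'
  · rw [← image_inter h.injective]; exact hAB.image h

theorem not_countable_Ioc_omega_one {c : Ordinal.{0}} (hc : c < ω₁) :
    ¬ (Ioc c ω₁).Countable := by
  intro h
  have : (Iic (ω₁ : Ordinal.{0})).Countable := by
    rw [← Iic_union_Ioc_eq_Iic hc.le]
    exact (countable_Iic_of_lt hc).union h
  exact lt_irrefl _ (lt_omega_one_of_countable_Iic this)

theorem mem_condPts_horizontal {S : Set (Ordinal.{0} × Ordinal.{0})} {p : S} {c : Ordinal.{0}}
    (hc : c < ω₁) (hp : p.1.1 = ω₁) (h : ∀ x, c < x → x ≤ ω₁ → (x, p.1.2) ∈ S) : p ∈ condPts S := by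
  rw [mem_condPts_subtype]
  obtain ⟨⟨x, y⟩, hpS⟩ := p
  obtain rfl : x = ω₁ := hp
  intro U hU hcount
  have hV : {z | (z, y) ∈ U} ∈ 𝓝 (ω₁ : Ordinal.{0}) :=
    (Continuous.prodMk_left y).continuousAt hU
  obtain ⟨a, ha, haV⟩ := exists_Ioc_subset_of_mem_nhds hV ⟨0, omega_pos 1⟩
  refine not_countable_Ioc_omega_one (max_lt hc ha) ?_
  refine MapsTo.countable_of_injOn (f := fun z => (z, y)) (t := S ∩ U) ?_
    (fun z _ w _ hzw => congrArg Prod.fst hzw) hcount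
  exact fun z hz => ⟨h z ((le_max_left _ _).trans_lt hz.1) hz.2,
    haV ⟨(le_max_right _ _).trans_lt hz.1, hz.2⟩⟩

theorem mem_condPts_vertical {S : Set (Ordinal.{0} × Ordinal.{0})} {p : S} {c : Ordinal.{0}}
    (hc : c < ω₁) (hp : p.1.2 = ω₁) (h : ∀ y, c < y → y ≤ ω₁ → (p.1.1, y) ∈ S) : p ∈ condPts S := by
  rw [mem_condPts_subtype]
  obtain ⟨⟨x, y⟩, hpS⟩ := p
  obtain rfl : y = ω₁ := hp
  intro U hU hcount
  have hV : {z | (x, z) ∈ U} ∈ 𝓝 (ω₁ : Ordinal.{0}) :=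
    (Continuous.prodMk_right x).continuousAt hU
  obtain ⟨a, ha, haV⟩ := exists_Ioc_subset_of_mem_nhds hV ⟨0, omega_pos 1⟩
  refine not_countable_Ioc_omega_one (max_lt hc ha) ?_
  refine MapsTo.countable_of_injOn (f := fun z => (x, z)) (t := S ∩ U) ?_
    (fun z _ w _ hzw => congrArg Prod.snd hzw) hcount
  exact fun z hz => ⟨h z ((le_max_left _ _).trans_lt hz.1) hz.2,
    haV ⟨(le_max_right _ _).trans_lt hz.1, hz.2⟩⟩

theorem mem_condPts_plank {α : Ordinal.{0}} (hα : α < ω₁)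
    {p : (Iic (ω₁ : Ordinal.{0}) ×ˢ Iic α : Set (Ordinal.{0} × Ordinal.{0}))} :
    p ∈ condPts (Iic (ω₁ : Ordinal.{0}) ×ˢ Iic α : Set (Ordinal.{0} × Ordinal.{0})) ↔
      p.1.1 = ω₁ := by
  constructor
  · intro h
    by_contra hne
    have hlt : p.1.1 < ω₁ := lt_of_le_of_ne p.2.1 hne
    rw [mem_condPts_subtype] at h
    refine h (Prod.fst ⁻¹' Iic p.1.1) (continuous_fst.continuousAt
      ((isClopen_Iic_ordinal _).isOpen.mem_nhds (le_refl p.1.1))) ?_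
    refine ((countable_Iic_of_lt hlt).prod (countable_Iic_of_lt hα)).mono ?_
    rintro ⟨x, y⟩ ⟨⟨-, h1⟩, h2⟩
    exact ⟨h2, h1⟩
  · intro h
    exact mem_condPts_horizontal (omega_pos 1) h fun x _ hx => ⟨hx, p.2.2⟩

theorem condPts_plank_countable {α : Ordinal.{0}} (hα : α < ω₁) :
    (condPts (Iic (ω₁ : Ordinal.{0}) ×ˢ Iic α : Set (Ordinal.{0} × Ordinal.{0}))).Countable := by
  refine MapsTo.countable_of_injOn (f := fun p => p.1.2) (t := Iic α) (fun p _ => p.2.2) ?_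
    (countable_Iic_of_lt hα)
  intro p hp q hq h
  exact Subtype.ext (Prod.ext (((mem_condPts_plank hα).1 hp).trans ((mem_condPts_plank hα).1 hq).symm)
    h)

/-- The right and top edges consist of condensation points and meet only in the corner. -/
theorem hasTwoEnds_square :
    HasTwoEnds (Iic (ω₁ : Ordinal.{0}) ×ˢ Iic (ω₁ : Ordinal.{0}) :
      Set (Ordinal.{0} × Ordinal.{0})) := by
  have hn : ¬ (Iic (ω₁ : Ordinal.{0})).Countable := fun h =>
    lt_irrefl _ (lt_omega_one_of_countable_Iic h)
  refine ⟨{p | p.1.1 = ω₁}, {p | p.1.2 = ω₁}, ?_, ?_, ?_, ?_, ?_, ?_, ?_⟩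
  · exact isClosed_eq (by fun_prop) continuous_const
  · exact isClosed_eq (by fun_prop) continuous_const
  · exact fun p hp => mem_condPts_horizontal (omega_pos 1) hp fun x _ hx => ⟨hx, p.2.2⟩
  · exact fun p hp => mem_condPts_vertical (omega_pos 1) hp fun x _ hx => ⟨p.2.1, hx⟩
  · intro h
    refine hn ((h.image fun p => p.1.2).mono fun y hy => ?_)
    exact ⟨⟨(ω₁, y), le_refl ω₁, hy⟩, rfl, rfl⟩
  · intro h
    refine hn ((h.image fun p => p.1.1).mono fun y hy => ?_)
    exact ⟨⟨(y, ω₁), hy, le_refl ω₁⟩, rfl, rfl⟩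
  · rintro p ⟨h1, h2⟩ q ⟨h3, h4⟩
    exact Subtype.ext (Prod.ext (h1.trans h3.symm) (h2.trans h4.symm))

theorem exists_mem_Ioo_of_not_countable {A : Set Ordinal.{0}} (hA : A ⊆ Iic ω₁)
    (hAc : ¬ A.Countable) {y : Ordinal.{0}} (hy : y < ω₁) : ∃ a ∈ A, y < a ∧ a < ω₁ := by
  by_contra! h
  refine hAc (((countable_Iic_of_lt hy).union (countable_singleton (ω₁ : Ordinal.{0}))).mono ?_)
  intro a ha
  rcases le_or_gt a y with h1 | h1
  · exact Or.inl h1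
  · exact Or.inr (le_antisymm (hA ha) (h a ha h1))

/-- Two uncountable closed subsets of `ω₁ + 1` have at least two common points. -/
theorem not_subsingleton_inter_of_not_countable {A B : Set Ordinal.{0}} (hA : A ⊆ Iic ω₁)
    (hB : B ⊆ Iic ω₁) (hAcl : IsClosed A) (hBcl : IsClosed B) (hAc : ¬ A.Countable)
    (hBc : ¬ B.Countable) : ¬ (A ∩ B).Subsingleton := by
  obtain ⟨d, hd⟩ := exists_adapted
    (φ := fun y β => (∃ a ∈ A, y < a ∧ a ≤ β) ∧ ∃ b ∈ B, y < b ∧ b ≤ β)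
    (fun y hy => by
      obtain ⟨a, ha, h1, h2⟩ := exists_mem_Ioo_of_not_countable hA hAc hy
      obtain ⟨b, hb, h3, h4⟩ := exists_mem_Ioo_of_not_countable hB hBc hy
      exact ⟨max a b, max_lt h2 h4, ⟨a, ha, h1, le_max_left _ _⟩, b, hb, h3, le_max_right _ _⟩)
    (fun y β β' h ⟨⟨a, ha, h1, h2⟩, b, hb, h3, h4⟩ =>
      ⟨⟨a, ha, h1, h2.trans h⟩, b, hb, h3, h4.trans h⟩)
  -- The growth condition puts a point of C in every block, so a closed C contains d l at every
  -- nonzero limit l; ω and ω₁ provide two common points.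
  have key : ∀ C : Set Ordinal.{0}, IsClosed C →
      (∀ ξ < ω₁, ∃ a ∈ C, d ξ < a ∧ a ≤ d (ξ + 1)) →
      ∀ l, l ≠ 0 → LimZero l → l ≤ ω₁ → d l ∈ C := by
    intro C hC hC' l h0 hl hl1
    by_contra hn
    have hpos : 0 < d l := hd.zero.symm.trans_lt (hd.lt_iff.2 (pos_iff_ne_zero.2 h0))
    obtain ⟨c, hc, hcC⟩ := exists_Ioc_subset_of_mem_nhds (hC.isOpen_compl.mem_nhds hn) ⟨0, hpos⟩
    obtain ⟨ξ, h1, h2⟩ := hd.exists_lt hl hc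
    obtain ⟨a, ha, h3, h4⟩ := hC' ξ (h1.trans_le hl1)
    exact hcC ⟨h2.trans h3, h4.trans (hd.le_iff.2 (hl ξ h1).le)⟩ ha
  have hω : LimZero ω := fun ξ hξ => isSuccLimit_omega0.add_one_lt hξ
  have hA' := key A hAcl fun ξ hξ => (hd.growth ξ hξ).1
  have hB' := key B hBcl fun ξ hξ => (hd.growth ξ hξ).2
  intro hs
  have h1 := hs ⟨hA' ω omega0_ne_zero hω omega0_lt_omega_one.le,
    hB' ω omega0_ne_zero hω omega0_lt_omega_one.le⟩
    ⟨hA' ω₁ (omega_pos 1).ne' limZero_omega_one le_rfl,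
      hB' ω₁ (omega_pos 1).ne' limZero_omega_one le_rfl⟩
  exact absurd (hd.normal.strictMono.injective h1) omega0_lt_omega_one.ne

theorem mem_condPts_lowerTriangle {p : SqLat.lowerTriangle} :
    p ∈ condPts SqLat.lowerTriangle ↔ p.1.1 = ω₁ := by
  constructor
  · intro h
    by_contra hne
    have hlt : p.1.1 < ω₁ := lt_of_le_of_ne p.2.2 hne
    rw [mem_condPts_subtype] at h
    refine h (Prod.fst ⁻¹' Iic p.1.1) (continuous_fst.continuousAt
      ((isClopen_Iic_ordinal _).isOpen.mem_nhds (le_refl p.1.1))) ?_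
    refine ((countable_Iic_of_lt hlt).prod (countable_Iic_of_lt hlt)).mono ?_
    rintro ⟨x, y⟩ ⟨⟨h1, -⟩, h2⟩
    exact ⟨h2, le_trans h1 h2⟩
  · intro h
    rcases (show p.1.2 ≤ ω₁ from p.2.1.trans p.2.2).lt_or_eq with h1 | h1
    · exact mem_condPts_horizontal h1 h fun x hx hx' => ⟨hx.le, hx'⟩
    -- The row of the corner is a single point, so uncountability is seen along the diagonal
    -- instead.
    · rw [mem_condPts_subtype]
      obtain ⟨⟨x, y⟩, hp⟩ := p
      obtain rfl : x = ω₁ := h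
      obtain rfl : y = ω₁ := h1
      intro U hU hc
      have hV : {z | (z, z) ∈ U} ∈ 𝓝 (ω₁ : Ordinal.{0}) :=
        (continuous_id.prodMk continuous_id).continuousAt hU
      obtain ⟨a, ha, haV⟩ := exists_Ioc_subset_of_mem_nhds hV ⟨0, omega_pos 1⟩
      refine not_countable_Ioc_omega_one ha ?_
      refine MapsTo.countable_of_injOn (f := fun z => (z, z)) (t := SqLat.lowerTriangle ∩ U) ?_
        (fun z _ w _ hzw => congrArg Prod.fst hzw) hc
      exact fun z hz => ⟨⟨le_rfl, hz.2⟩, haV hz⟩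

theorem not_countable_condPts_lowerTriangle : ¬ (condPts SqLat.lowerTriangle).Countable := by
  intro h
  refine lt_irrefl _ (lt_omega_one_of_countable_Iic ((h.image fun p => p.1.2).mono fun y hy => ?_))
  exact ⟨⟨(ω₁, y), hy, le_rfl⟩, mem_condPts_lowerTriangle.2 rfl, rfl⟩

/-- The condensation points form a single edge, which the height embeds into ω₁ + 1, where two
uncountable closed sets share two points. -/
theorem not_hasTwoEnds_lowerTriangle : ¬ HasTwoEnds SqLat.lowerTriangle := by
  rintro ⟨A, B, hA, hB, hA', hB', hAc, hBc, hAB⟩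
  have : CompactSpace SqLat.lowerTriangle :=
    isCompact_iff_compactSpace.1 SqLat.stair_lowerTriangle.compact
  let f : SqLat.lowerTriangle → Ordinal.{0} := fun p => p.1.2
  have hf : Continuous f := by fun_prop
  have hinj : InjOn f (condPts SqLat.lowerTriangle) := fun p hp q hq h =>
    Subtype.ext (Prod.ext ((mem_condPts_lowerTriangle.1 hp).trans
      (mem_condPts_lowerTriangle.1 hq).symm) h)
  have hsub : ∀ A : Set SqLat.lowerTriangle, f '' A ⊆ Iic ω₁ := by
    rintro A _ ⟨p, -, rfl⟩
    exact p.2.1.trans p.2.2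
  refine not_subsingleton_inter_of_not_countable (hsub A) (hsub B) (hA.isCompact.image hf).isClosed
    (hB.isCompact.image hf).isClosed
    (fun h => hAc (countable_of_injective_of_countable_image (hinj.mono hA') h))
    (fun h => hBc (countable_of_injective_of_countable_image (hinj.mono hB') h)) ?_
  rw [← hinj.image_inter hA' hB']
  exact hAB.image f

theorem HasTwoEnds.not_countable {X : Type*} [TopologicalSpace X] (h : HasTwoEnds X) :
    ¬ (condPts X).Countable := by
  obtain ⟨A, B, -, -, hA, -, hAc, -⟩ := h
  exact fun hc => hAc (hc.mono hA)

/-! ### Cantor–Bendixson derivatives of ordinals -/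

/-- Iterated derived sets. -/
noncomputable def cbDeriv (X : Type*) [TopologicalSpace X] (γ : Ordinal.{0}) : Set X :=
  {x | ∀ γ' : Iio γ, AccPt x (𝓟 (cbDeriv X γ'))}
termination_by γ
decreasing_by exact γ'.2

theorem mem_cbDeriv {X : Type*} [TopologicalSpace X] {γ : Ordinal.{0}} {x : X} :
    x ∈ cbDeriv X γ ↔ ∀ γ' < γ, ∀ U ∈ 𝓝 x, ∃ y ∈ U ∩ cbDeriv X γ', y ≠ x := by
  rw [cbDeriv]
  simp only [mem_ofPred_eq, accPt_iff_nhds, Subtype.forall, mem_Iio]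

theorem Homeomorph.mem_cbDeriv {X Y : Type*} [TopologicalSpace X] [TopologicalSpace Y]
    (h : X ≃ₜ Y) {γ : Ordinal.{0}} {x : X} (hx : x ∈ cbDeriv X γ) : h x ∈ cbDeriv Y γ := by
  induction γ using WellFoundedLT.induction generalizing x with
  | ind γ ih =>
    rw [_root_.mem_cbDeriv] at hx ⊢
    intro γ' hγ' U hU
    obtain ⟨y, ⟨hy1, hy2⟩, hy3⟩ := hx γ' hγ' _ (h.continuous.continuousAt hU)
    exact ⟨h y, ⟨hy1, ih γ' hγ' hy2⟩, fun h' => hy3 (h.injective h')⟩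

/-- The neighbourhood `Iic x` contains only smaller points besides x, and by induction these have
rank at most themselves. -/
theorem le_of_mem_cbDeriv {α γ : Ordinal.{0}} {x : Iic α} (hx : x ∈ cbDeriv (Iic α) γ) :
    γ ≤ x.1 := by
  obtain ⟨x, hxα⟩ := x
  induction x using WellFoundedLT.induction generalizing γ with
  | ind x ih =>
    by_contra! hlt
    rw [mem_cbDeriv] at hx
    have hU : Subtype.val ⁻¹' Iic x ∈ 𝓝 (⟨x, hxα⟩ : Iic α) :=
      continuous_subtype_val.continuousAt ((isClopen_Iic_ordinal x).isOpen.mem_nhds (le_refl x))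
    obtain ⟨⟨y, hyα⟩, ⟨hy1, hy2⟩, hy3⟩ := hx x hlt _ hU
    have hyx : y < x := lt_of_le_of_ne hy1 fun h => hy3 (Subtype.ext h)
    exact absurd (ih y hyx hyα hy2) (not_le.2 hyx)

/-- For γ' < γ, a nonzero multiple of ω ^ γ is a limit of smaller nonzero multiples of ω ^ γ'. -/
theorem mul_mem_cbDeriv {β γ δ : Ordinal.{0}} (hδ : δ ≠ 0) (h : ω ^ γ * δ ≤ β) :
    (⟨ω ^ γ * δ, h⟩ : Iic β) ∈ cbDeriv (Iic β) γ := by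
  induction γ using WellFoundedLT.induction generalizing δ with
  | ind γ ih =>
    rw [mem_cbDeriv]
    intro γ' hγ' U hU
    rw [nhds_subtype, mem_comap] at hU
    obtain ⟨V, hV, hVU⟩ := hU
    have hpos : 0 < ω ^ γ * δ := mul_pos (Ordinal.opow_pos _ omega0_pos) (pos_iff_ne_zero.2 hδ)
    obtain ⟨c, hc, hcV⟩ := exists_Ioc_subset_of_mem_nhds hV ⟨0, hpos⟩
    have heq : ω ^ γ * δ = ω ^ γ' * (ω ^ (γ - γ') * δ) := by
      rw [← mul_assoc, ← Ordinal.opow_add, Ordinal.add_sub_cancel_of_le hγ'.le]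
    have hlim : IsSuccLimit (ω ^ (γ - γ') * δ) := 
      Ordinal.isSuccLimit_mul_left (Ordinal.isSuccLimit_opow_left isSuccLimit_omega0
        (Ordinal.sub_ne_zero_iff_lt.2 hγ')) (pos_iff_ne_zero.2 hδ)
    have hc' : c < ω ^ γ' * (ω ^ (γ - γ') * δ) := heq ▸ hc
    obtain ⟨ζ, hζ, hcζ⟩ := (lt_mul_iff_of_isSuccLimit hlim).1 hc'
    have hlt : ω ^ γ' * ζ < ω ^ γ * δ := by
      rw [heq]; exact (mul_lt_mul_iff_right₀ (Ordinal.opow_pos _ omega0_pos)).2 hζ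
    have hζ0 : ζ ≠ 0 := by
      rintro rfl
      rw [mul_zero] at hcζ
      exact not_lt_zero hcζ
    exact ⟨⟨ω ^ γ' * ζ, hlt.le.trans h⟩, ⟨hVU (hcV ⟨hcζ, hlt.le⟩), ih γ' hγ' hζ0 _⟩,
      fun h' => hlt.ne (congrArg Subtype.val h')⟩

/-- Otherwise ω ^ (α + 1) would be a point of rank at least α + 1 in α + 1, where ranks are at most
α. This crude bound suffices for counting. -/
theorem lt_of_homeomorph_Iic {α β : Ordinal.{0}} (h : Iic β ≃ₜ Iic α) : β < ω ^ (α + 1) := by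
  by_contra! hle
  have h1 := mul_mem_cbDeriv (β := β) (γ := α + 1) (δ := 1) one_ne_zero (by simpa using hle)
  have h2 := le_of_mem_cbDeriv (h.mem_cbDeriv h1)
  exact absurd (h2.trans (h _).2) (not_le.2 (Order.lt_add_one_iff.2 le_rfl))

noncomputable def condPtsPlankHomeomorph {α : Ordinal.{0}} (hα : α < ω₁) :
    condPts (Iic (ω₁ : Ordinal.{0}) ×ˢ Iic α : Set (Ordinal.{0} × Ordinal.{0})) ≃ₜ Iic α where
  toFun p := ⟨p.1.1.2, p.1.2.2⟩
  invFun y := ⟨⟨(ω₁, y.1), le_refl ω₁, y.2⟩, (mem_condPts_plank hα).2 rfl⟩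
  left_inv p := Subtype.ext (Subtype.ext (Prod.ext ((mem_condPts_plank hα).1 p.2).symm rfl))
  right_inv y := rfl
  continuous_toFun := by fun_prop
  continuous_invFun := by fun_prop

theorem lt_of_setHomeo_plank {α β : Ordinal.{0}} (hα : α < ω₁) (hβ : β < ω₁)
    (h : SetHomeo (Iic (ω₁ : Ordinal.{0}) ×ˢ Iic β) (Iic (ω₁ : Ordinal.{0}) ×ˢ Iic α)) :
    β < ω ^ (α + 1) := by
  obtain ⟨h⟩ := h
  have e1 := h.image (condPts _)
  rw [h.image_condPts] at e1
  exact lt_of_homeomorph_Iic ((condPtsPlankHomeomorph hβ).symm.trans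
    (e1.trans (condPtsPlankHomeomorph hα)))

/-! ### Transfer to sublattices of the square -/

instance compactSpace_ordSpace (α : Ordinal.{0}) : CompactSpace (OrdSpace α) :=
  isCompact_iff_compactSpace.1 (isCompact_Iic_ordinal α)

/-- The inclusion of the square into the pairs of ordinals. -/
def GSquare.toPair (p : GSquare) : Ordinal.{0} × Ordinal.{0} := (p.1.1, p.2.1)

theorem GSquare.continuous_toPair : Continuous GSquare.toPair := by
  unfold GSquare.toPair; fun_prop

theorem GSquare.toPair_injective : Function.Injective GSquare.toPair := fun _ _ h =>
  Prod.ext (Subtype.ext (congrArg Prod.fst h)) (Subtype.ext (congrArg Prod.snd h))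

theorem setHomeo_toPair {S : Set GSquare} (hS : IsClosed S) : SetHomeo S (GSquare.toPair '' S) :=
  SetHomeo.image hS.isCompact GSquare.continuous_toPair.continuousOn
    GSquare.toPair_injective.injOn

theorem sqLat_toPair {K : Sublattice GSquare} (hK : IsClosed (K : Set GSquare)) :
    SqLat (GSquare.toPair '' (K : Set GSquare)) where
  compact := hK.isCompact.image GSquare.continuous_toPair
  sub := by
    rintro _ ⟨p, -, rfl⟩
    exact ⟨p.1.2, p.2.2⟩
  sup := by
    have h : ∀ p ∈ K, ∀ q ∈ K, (max p.toPair.1 q.toPair.1, max p.toPair.2 q.toPair.2) ∈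
        GSquare.toPair '' (K : Set GSquare) := fun p hp q hq => ⟨p ⊔ q, K.sup_mem hp hq, rfl⟩
    rintro x y x' y' ⟨p, hp, h1⟩ ⟨q, hq, h2⟩
    have := h p hp q hq
    rwa [h1, h2] at this
  inf := by
    have h : ∀ p ∈ K, ∀ q ∈ K, (min p.toPair.1 q.toPair.1, min p.toPair.2 q.toPair.2) ∈
        GSquare.toPair '' (K : Set GSquare) := fun p hp q hq => ⟨p ⊓ q, K.inf_mem hp hq, rfl⟩
    rintro x y x' y' ⟨p, hp, h1⟩ ⟨q, hq, h2⟩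
    have := h p hp q hq
    rwa [h1, h2] at this

theorem nonempty_homeomorph_triangle : Nonempty (triangle ≃ₜ SqLat.lowerTriangle) := by
  have hcl : IsClosed triangle := isClosed_le continuous_fst continuous_snd
  refine (setHomeo_toPair hcl).trans ((SqLat.setHomeo_swap
    (hcl.isCompact.image GSquare.continuous_toPair)).trans ?_)
  have : Prod.swap '' (GSquare.toPair '' triangle) = SqLat.lowerTriangle := by
    ext ⟨x, y⟩
    rw [SqLat.mem_swap]
    constructor
    · rintro ⟨p, hp, h⟩
      cases h
      exact ⟨hp, p.2.2⟩
    · rintro ⟨h1, h2⟩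
      exact ⟨(⟨y, h1.trans h2⟩, ⟨x, h2⟩), h1, rfl⟩
  rw [this]
  exact SetHomeo.refl _

theorem setHomeo_iff_plank {X : Type*} [TopologicalSpace X] (α : Ordinal.{0}) :
    Nonempty (X ≃ₜ GPlank α) ↔
      Nonempty (X ≃ₜ (Iic (ω₁ : Ordinal.{0}) ×ˢ Iic α : Set (Ordinal.{0} × Ordinal.{0}))) :=
  ⟨fun ⟨h⟩ => ⟨h.trans (Homeomorph.Set.prod _ _).symm⟩, fun ⟨h⟩ => ⟨h.trans (Homeomorph.Set.prod _ _)⟩⟩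

theorem classification (K : Sublattice GSquare) (hK : IsClosed (K : Set GSquare))
    (hunc : ¬ (K : Set GSquare).Countable) :
    Nonempty (K ≃ₜ triangle) ∨ Nonempty (K ≃ₜ GSquare) ∨
      ∃ α : Ordinal.{0}, α < ω₁ ∧ Nonempty (K ≃ₜ GPlank α) := by
  have h := setHomeo_toPair hK
  rcases (sqLat_toPair hK).classified (fun hc => hunc (h.symm.countable hc)) with h1 | h1 | ⟨β, hβ, h1⟩
  · obtain ⟨e⟩ := nonempty_homeomorph_triangle
    exact Or.inl ⟨(h.trans h1).some.trans e.symm⟩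
  · exact Or.inr (Or.inl ((setHomeo_iff_plank _).2 (h.trans h1)))
  · exact Or.inr (Or.inr ⟨β, hβ, (setHomeo_iff_plank _).2 (h.trans h1)⟩)

section Exclusive

variable {X : Type*} [TopologicalSpace X]

theorem HasTwoEnds.of_square (h : Nonempty (X ≃ₜ GSquare)) : HasTwoEnds X := by
  obtain ⟨e⟩ := (setHomeo_iff_plank _).1 h
  exact hasTwoEnds_square.of_homeomorph e.symm

theorem not_hasTwoEnds_of_triangle (h : Nonempty (X ≃ₜ triangle)) : ¬ HasTwoEnds X := fun hX =>
  not_hasTwoEnds_lowerTriangle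
    (hX.of_homeomorph (h.some.trans nonempty_homeomorph_triangle.some))

theorem countable_condPts_of_plank {α : Ordinal.{0}} (hα : α < ω₁) (h : Nonempty (X ≃ₜ GPlank α)) :
    (condPts X).Countable := by
  obtain ⟨e⟩ := (setHomeo_iff_plank _).1 h
  rw [← e.symm.image_condPts]
  exact (condPts_plank_countable hα).image _

theorem not_countable_condPts_of_triangle (h : Nonempty (X ≃ₜ triangle)) :
    ¬ (condPts X).Countable := by
  rw [← (h.some.trans nonempty_homeomorph_triangle.some).symm.image_condPts]
  exact fun hc => not_countable_condPts_lowerTriangle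
    (countable_of_injective_of_countable_image (Homeomorph.injective _).injOn hc)

end Exclusive

/-! ### Counting the types -/

/-- The plank `(ω₁ + 1) × (α + 1)` as a sublattice of the square. -/
def plankSublattice (α : Ordinal.{0}) : Sublattice GSquare where
  carrier := {p | p.2.1 ≤ α}
  supClosed' := fun _ hp _ hq => max_le (c := α) hp hq
  infClosed' := fun p hp q _ => (min_le_left p.2.1 q.2.1).trans (show p.2.1 ≤ α from hp)

theorem coe_plankSublattice (α : Ordinal.{0}) :
    (plankSublattice α : Set GSquare) = {p | p.2.1 ≤ α} := rfl

theorem isClosed_plankSublattice (α : Ordinal.{0}) :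
    IsClosed (plankSublattice α : Set GSquare) := by
  rw [coe_plankSublattice]
  exact isClosed_le (f := fun p : GSquare => p.2.1) (g := fun _ => α) (by fun_prop) continuous_const

theorem plankSublattice_homeo {α : Ordinal.{0}} (hα : α < ω₁) :
    Nonempty (plankSublattice α ≃ₜ GPlank α) := by
  rw [setHomeo_iff_plank]
  refine (setHomeo_toPair (isClosed_plankSublattice α)).trans ?_
  have : GSquare.toPair '' (plankSublattice α : Set GSquare) = Iic (ω₁ : Ordinal.{0}) ×ˢ Iic α := by
    rw [coe_plankSublattice]
    ext ⟨x, y⟩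
    constructor
    · rintro ⟨p, hp, h⟩
      cases h
      exact ⟨p.1.2, hp⟩
    · rintro ⟨h1, h2⟩
      exact ⟨(⟨x, h1⟩, ⟨y, le_trans h2 hα.le⟩), h2, rfl⟩
  rw [this]
  exact SetHomeo.refl _

theorem not_countable_plankSublattice (α : Ordinal.{0}) :
    ¬ (plankSublattice α : Set GSquare).Countable := by
  intro h
  rw [coe_plankSublattice] at h
  refine lt_irrefl _ (lt_omega_one_of_countable_Iic ((h.image fun p => p.1.1).mono fun x hx => ?_))
  exact ⟨(⟨x, hx⟩, ⟨0, (omega_pos 1).le⟩), zero_le (a := α), rfl⟩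

/-- The topological type of a plank. -/
def plankType (α : Ordinal.{0}) : TopologicalTypes :=
  Quotient.mk homeoSetoid
    ⟨plankSublattice α, isClosed_plankSublattice α, not_countable_plankSublattice α⟩

theorem mk_Iio_omega_one : #(Iio (ω₁ : Ordinal.{0})) = ℵ₁ := by
  rw [Cardinal.mk_Iio_ordinal, Ordinal.card_omega, Cardinal.lift_aleph, Ordinal.lift_one]

theorem mk_topologicalTypes_le : #TopologicalTypes ≤ ℵ₁ := by
  let A : Set TopologicalTypes :=
    {t | ∃ K : UncountableClosedSublattice, Nonempty (K.1 ≃ₜ triangle) ∧ Quotient.mk homeoSetoid K = t}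
  let B : Set TopologicalTypes :=
    {t | ∃ K : UncountableClosedSublattice, Nonempty (K.1 ≃ₜ GSquare) ∧ Quotient.mk homeoSetoid K = t}
  let C : Set TopologicalTypes := plankType '' Iio ω₁
  have hA : A.Subsingleton := by
    rintro _ ⟨K, ⟨h⟩, rfl⟩ _ ⟨L, ⟨k⟩, rfl⟩
    exact Quotient.sound ⟨h.trans k.symm⟩
  have hB : B.Subsingleton := by
    rintro _ ⟨K, ⟨h⟩, rfl⟩ _ ⟨L, ⟨k⟩, rfl⟩
    exact Quotient.sound ⟨h.trans k.symm⟩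
  have hC : #C ≤ ℵ₁ := mk_Iio_omega_one ▸ Cardinal.mk_image_le
  have hAB : #(A ∪ B : Set TopologicalTypes) ≤ ℵ₁ :=
    (Cardinal.le_aleph0_iff_set_countable.2 (hA.countable.union hB.countable)).trans
      (Cardinal.aleph0_le_aleph 1)
  have hcover : Set.univ ⊆ A ∪ B ∪ C := by
    rintro t -
    induction t using Quotient.inductionOn with
    | h K =>
      rcases classification K.1 K.2.1 K.2.2 with h | h | ⟨α, hα, ⟨h⟩⟩
      · exact Or.inl (Or.inl ⟨K, h, rfl⟩)
      · exact Or.inl (Or.inr ⟨K, h, rfl⟩)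
      · refine Or.inr ⟨α, hα, Quotient.sound ?_⟩
        exact ⟨(plankSublattice_homeo hα).some.trans h.symm⟩
  rw [← Cardinal.mk_univ]
  refine (Cardinal.mk_le_mk_of_subset hcover).trans ((Cardinal.mk_union_le _ _).trans ?_)
  exact Cardinal.add_le_of_le (Cardinal.aleph0_le_aleph 1) hAB hC

/-- Each type is that of only countably many planks, namely of β < ω ^ (α + 1) once it contains α.
Countably many types would make ω₁ a countable union of countable sets. -/
theorem le_mk_topologicalTypes : ℵ₁ ≤ #TopologicalTypes := by
  by_contra! h
  rw [← Cardinal.succ_aleph0, Order.lt_succ_iff, Cardinal.mk_le_aleph0_iff] at h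
  have hfib : ∀ t : TopologicalTypes, {α : Ordinal.{0} | α < ω₁ ∧ plankType α = t}.Countable := by
    intro t
    rcases Set.eq_empty_or_nonempty {α : Ordinal.{0} | α < ω₁ ∧ plankType α = t} with h | ⟨α, hα, rfl⟩
    · rw [h]; exact countable_empty
    · have hlt : ω ^ (α + 1) < ω₁ := by
        rw [lt_omega_one_iff_card]
        refine (Ordinal.card_opow_le _ _).trans (max_le le_rfl (max_le (by simp) ?_))
        exact lt_omega_one_iff_card.1 (succ_lt_omega_one hα)
      refine (countable_Iio_iff_lt_omega_one.2 hlt).mono ?_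
      rintro β ⟨hβ, hβα⟩
      obtain ⟨e⟩ : Nonempty (plankSublattice β ≃ₜ plankSublattice α) := Quotient.exact hβα
      refine lt_of_setHomeo_plank hα hβ ?_
      obtain ⟨e1⟩ := (setHomeo_iff_plank _).1 (plankSublattice_homeo hα)
      obtain ⟨e2⟩ := (setHomeo_iff_plank _).1 (plankSublattice_homeo hβ)
      exact ⟨e2.symm.trans (e.trans e1)⟩
  have : (Iio (ω₁ : Ordinal.{0})).Countable :=
    by
    refine (countable_iUnion hfib).mono fun α hα => ?_
    exact mem_iUnion.2 ⟨plankType α, hα, rfl⟩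
  exact lt_irrefl _ (countable_Iio_iff_lt_omega_one.1 this)

theorem theorem5p3 :
    (∀ K : Sublattice GSquare, IsClosed (K : Set GSquare) → ¬ (K : Set GSquare).Countable →
      (Nonempty (K ≃ₜ triangle) ∨ Nonempty (K ≃ₜ GSquare) ∨
        ∃ α : Ordinal.{0}, α < ω₁ ∧ Nonempty (K ≃ₜ GPlank α)) ∧
      ¬ (Nonempty (K ≃ₜ triangle) ∧ Nonempty (K ≃ₜ GSquare)) ∧
      ¬ (Nonempty (K ≃ₜ triangle) ∧
        ∃ α : Ordinal.{0}, α < ω₁ ∧ Nonempty (K ≃ₜ GPlank α)) ∧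
      ¬ (Nonempty (K ≃ₜ GSquare) ∧
        ∃ α : Ordinal.{0}, α < ω₁ ∧ Nonempty (K ≃ₜ GPlank α))) ∧
    #TopologicalTypes = ℵ₁ := by
  refine ⟨fun K hK hunc => ⟨classification K hK hunc, ?_, ?_, ?_⟩,
    le_antisymm mk_topologicalTypes_le le_mk_topologicalTypes⟩
  · rintro ⟨h1, h2⟩
    exact not_hasTwoEnds_of_triangle h1 (HasTwoEnds.of_square h2)
  · rintro ⟨h1, α, hα, h2⟩
    exact not_countable_condPts_of_triangle h1 (countable_condPts_of_plank hα h2)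
  · rintro ⟨h1, α, hα, h2⟩
    exact (HasTwoEnds.of_square h1).not_countable (countable_condPts_of_plank hα h2)
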